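/- For a knot $K\subset S^3$ let $\nabla_K(z)$ be its Conway polynomial (the polynomial with $\nabla_K(0)=1$ such that $\nabla_K(t^{1/2}-t^{-1/2})$ is an Alexander polynomial of $K$), let $V_K(t)$ be its Jones polynomial, and put $v_3(K)=-\frac1{144}V_K'''(1)-\frac1{48}V_K''(1)$ (so that $v_3=\frac14$ for the right-handed trefoil). 1. Let $\ell,m$ be even integers and let $J(\ell,m)$ be the double twist knot with $|\ell|$ and $|m|$ half twists in its two twist regions (one with vertical, one with horizontal strands), where the crossings of the first region are negative if $\ell>0$ and positive if $\ell<0$, and likewise for $m$ and the second region; for instance $J(2,2)$ is the left-handed trefoil and $J(2,-2)$ is the figure-eight knot. Then $$\nabla_{J(\ell,m)}(z)=1+\frac{\ell m}{4}z^2,\qquad v_3(J(\ell,m))=-\frac{\ell m}{64}(\ell+m).$$ 2. Let $p,q,r$ be positive odd integers and let $P(p,q,r)$ be the 3-pretzel knot with $p,q,r$ half twists in its three columns, all crossings being positive; for instance $P(1,1,1)$ is the right-handed trefoil. Then $$\nabla_{P(p,q,r)}(z)=1+\frac14(pq+qr+rp+1)z^2,$$ $$v_3(P(p,q,r))=\frac1{64}\bigl((p+q+r+1)(pq+qr+rp+1)+(p-1)(q-1)(r-1)\bigr).$$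 -/

import Mathlib

open scoped LaurentPolynomial

/-- The combinatorial data of an oriented diagram of a closed curve on an oriented surface.
The diagram is cut into oriented edges.  The head of the edge `e` is the tail of `next e`.
At every crossing `c` one edge `overIn c` runs into `c` along the overpassing strand and leaves it as
`next (overIn c)`, and one edge `underIn c` runs into `c` along the underpassing strand and leaves it as
`next (underIn c)`.  An edge that is neither some `overIn c` nor some `underIn c` ends at a plain point of
the curve, so that a circle without crossings is allowed.  `sign c` is the usual sign of a crossing.

The four edges at `c`, in counterclockwise order, are
`underIn c, next (overIn c), next (underIn c), overIn c` at a positive crossing and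
`underIn c, overIn c, next (underIn c), next (overIn c)` at a negative one. -/
structure GaussData where
  Edge : Type
  Crossing : Type
  [fintypeEdge : Fintype Edge]
  [decidableEqEdge : DecidableEq Edge]
  [fintypeCrossing : Fintype Crossing]
  [decidableEqCrossing : DecidableEq Crossing]
  next : Equiv.Perm Edge
  overIn : Crossing → Edge
  underIn : Crossing → Edge
  sign : Crossing → ℤˣ

namespace GaussData

attribute [instance] fintypeEdge decidableEqEdge fintypeCrossing decidableEqCrossing

/-- The edge `e` does not run into a crossing. -/
def IsPlain (D : GaussData) (e : D.Edge) : Prop :=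
  ∀ c : D.Crossing, D.overIn c ≠ e ∧ D.underIn c ≠ e

/-- An edge together with a direction (`true`: along the orientation, `false`: against it). -/
abbrev Dart (D : GaussData) : Type := D.Edge × Bool

/-- Walking along the boundary of a region that lies on the right-hand side: after the dart `d`
comes the dart that follows by turning right at the endpoint of `d`. -/
inductive FaceStep (D : GaussData) : D.Dart → D.Dart → Prop
  | plain_forward (e : D.Edge) (h : D.IsPlain e) : FaceStep D (e, true) (D.next e, true)
  | plain_backward (e : D.Edge) (h : D.IsPlain e) : FaceStep D (D.next e, false) (e, false)
  | pos_under (c : D.Crossing) (h : D.sign c = 1) :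
      FaceStep D (D.underIn c, true) (D.next (D.overIn c), true)
  | pos_over_back (c : D.Crossing) (h : D.sign c = 1) :
      FaceStep D (D.next (D.overIn c), false) (D.next (D.underIn c), true)
  | pos_under_back (c : D.Crossing) (h : D.sign c = 1) :
      FaceStep D (D.next (D.underIn c), false) (D.overIn c, false)
  | pos_over (c : D.Crossing) (h : D.sign c = 1) :
      FaceStep D (D.overIn c, true) (D.underIn c, false)
  | neg_under (c : D.Crossing) (h : D.sign c = -1) :
      FaceStep D (D.underIn c, true) (D.overIn c, false)
  | neg_over (c : D.Crossing) (h : D.sign c = -1) :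
      FaceStep D (D.overIn c, true) (D.next (D.underIn c), true)
  | neg_under_back (c : D.Crossing) (h : D.sign c = -1) :
      FaceStep D (D.next (D.underIn c), false) (D.next (D.overIn c), true)
  | neg_over_back (c : D.Crossing) (h : D.sign c = -1) :
      FaceStep D (D.next (D.overIn c), false) (D.underIn c, false)

/-- The complementary regions of the diagram. -/
def Face (D : GaussData) : Type := Quot D.FaceStep

end GaussData

/-- An oriented knot diagram on the sphere: distinct passages through crossings belong to distinct
edges, there is exactly one component, and the Euler characteristic
`(number of vertices) - (number of edges) + (number of faces)`, which equals
`(number of faces) - (number of crossings)`, has its largest possible value `2`. -/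
structure KnotDiagram extends GaussData where
  nonempty_edge : Nonempty Edge
  injective_passage : Function.Injective (Sum.elim overIn underIn)
  one_component : next.IsCycleOn Set.univ
  planar : Fintype.card Crossing + 2 ≤ Nat.card toGaussData.Face

namespace KnotDiagram

/-! ### The Kauffman bracket, the Jones polynomial and `v₃` -/

/-- The sum of the signs of all crossings. -/
def writhe (D : KnotDiagram) : ℤ := ∑ c : D.Crossing, (D.sign c : ℤ)

/-- A state chooses at each crossing the `A`-smoothing (`true`), which joins the two regions swept
out when the overpass is turned counterclockwise, or the `B`-smoothing (`false`).
The `A`-smoothing of a positive crossing and the `B`-smoothing of a negative crossing are the ones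
that respect the orientation. -/
abbrev State (D : KnotDiagram) : Type := D.Crossing → Bool

/-- Two edges are joined directly when the diagram is smoothed according to the state `s`. -/
inductive Joined (D : KnotDiagram) (s : D.State) : D.Edge → D.Edge → Prop
  | plain (e : D.Edge) (h : D.IsPlain e) : Joined D s e (D.next e)
  | oriented_under (c : D.Crossing) (h : s c = true ↔ D.sign c = 1) :
      Joined D s (D.underIn c) (D.next (D.overIn c))
  | oriented_over (c : D.Crossing) (h : s c = true ↔ D.sign c = 1) :
      Joined D s (D.overIn c) (D.next (D.underIn c))
  | unoriented_in (c : D.Crossing) (h : ¬(s c = true ↔ D.sign c = 1)) :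
      Joined D s (D.underIn c) (D.overIn c)
  | unoriented_out (c : D.Crossing) (h : ¬(s c = true ↔ D.sign c = 1)) :
      Joined D s (D.next (D.underIn c)) (D.next (D.overIn c))

/-- The number of circles of the smoothed diagram. -/
noncomputable def loops (D : KnotDiagram) (s : D.State) : ℕ := Nat.card (Quot (D.Joined s))

/-- The Kauffman bracket `∑ₛ A ^ (a(s) - b(s)) * (-A² - A⁻²) ^ (loops s - 1)` in `ℤ[A, A⁻¹]`, where
`a(s)` and `b(s)` are the numbers of `A`- and `B`-smoothings. -/
noncomputable def kauffmanBracket (D : KnotDiagram) : ℤ[T;T⁻¹] :=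
  ∑ s : D.State,
    LaurentPolynomial.T (∑ c, if s c then 1 else -1) *
      (-LaurentPolynomial.T 2 - LaurentPolynomial.T (-2)) ^ (D.loops s - 1)

/-- The normalized bracket `(-A³) ^ (-writhe) * ⟨D⟩`. -/
noncomputable def normalizedBracket (D : KnotDiagram) : ℤ[T;T⁻¹] :=
  LaurentPolynomial.C (((-1 : ℤˣ) ^ D.writhe : ℤˣ) : ℤ) * LaurentPolynomial.T (-3 * D.writhe) *
    D.kauffmanBracket

/-- The Jones polynomial `V(t)`, as a function of `t > 0`: the normalized bracket at
`A = t ^ (-1/4) = exp (-(log t) / 4)`. -/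
noncomputable def jones (D : KnotDiagram) (t : ℝ) : ℝ :=
  LaurentPolynomial.eval₂ (Int.castRingHom ℝ)
    (Units.mk0 (Real.exp (-Real.log t / 4)) (Real.exp_ne_zero _)) D.normalizedBracket

/-- The degree three invariant `v₃ = -V'''(1)/144 - V''(1)/48`. -/
noncomputable def v₃ (D : KnotDiagram) : ℝ :=
  -(1 / 144) * iteratedDeriv 3 D.jones 1 - (1 / 48) * iteratedDeriv 2 D.jones 1

/-! ### The Alexander ideal and the Conway polynomial -/

/-- The Alexander matrix over `ℤ[t, t⁻¹]` (Fox calculus for the Wirtinger presentation).  The columns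
are the generators `x_e`, one for each edge, and the row of `e` is the relation at the head of `e`:
`x_{next e} = x_e` unless `e = underIn c`, and for `e = underIn c` with `ε = sign c`
`x_{next e} = t ^ (-ε) * x_e + (1 - t ^ (-ε)) * x_{overIn c}`. -/
noncomputable def alexanderMatrix (D : KnotDiagram) : Matrix D.Edge D.Edge ℤ[T;T⁻¹] :=
  Matrix.of (fun e f => (if D.next e = f then 1 else 0) - (if e = f then 1 else 0)) +
    ∑ c : D.Crossing, ((1 : ℤ[T;T⁻¹]) - LaurentPolynomial.T (-(D.sign c : ℤ))) •
      (Matrix.single (D.underIn c) (D.underIn c) 1 - Matrix.single (D.underIn c) (D.overIn c) 1)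

/-- The Alexander ideal (first elementary ideal), generated by the minors of the Alexander matrix
with one row and one column deleted; up to sign these are the entries of the adjugate matrix. -/
noncomputable def alexanderIdeal (D : KnotDiagram) : Ideal ℤ[T;T⁻¹] :=
  Ideal.span (Set.range fun ef : D.Edge × D.Edge => D.alexanderMatrix.adjugate ef.1 ef.2)

/-- The substitution `t = s²`. -/
noncomputable def substSq : ℤ[T;T⁻¹] →+* ℤ[T;T⁻¹] :=
  LaurentPolynomial.eval₂ LaurentPolynomial.C
    (LaurentPolynomial.isUnit_T (R := ℤ) 2).unit

/-- The substitution `z = s - s⁻¹`. -/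
noncomputable def substZ : Polynomial ℤ →+* ℤ[T;T⁻¹] :=
  Polynomial.eval₂RingHom LaurentPolynomial.C (LaurentPolynomial.T 1 - LaurentPolynomial.T (-1))

/-- `P` is the Conway polynomial of the knot: `P(0) = 1`, and `P(t^{1/2} - t^{-1/2})` is an Alexander
polynomial of the knot, i.e. a generator of the Alexander ideal. -/
def IsConway (D : KnotDiagram) (P : Polynomial ℤ) : Prop :=
  P.coeff 0 = 1 ∧ Ideal.span {substZ P} = D.alexanderIdeal.map substSq

open LaurentPolynomial in
/-- The units of `ℤ[T, T⁻¹]` are monomials. -/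
theorem exists_eq_of_isUnit {u : ℤ[T;T⁻¹]} (h : IsUnit u) :
    ∃ a k : ℤ, IsUnit a ∧ u = C a * T k := by
  obtain ⟨w, hw⟩ := h.exists_right_inv
  obtain ⟨n, p, hp⟩ := u.exists_T_pow
  obtain ⟨m, q, hq⟩ := w.exists_T_pow
  have h1 : p * q = Polynomial.X ^ (n + m) := by
    apply Polynomial.toLaurent_injective
    rw [map_mul, hp, hq, Polynomial.toLaurent_X_pow, Nat.cast_add, T_add]
    linear_combination (T n * T m : ℤ[T;T⁻¹]) * hw
  obtain ⟨i, -, v, hv⟩ := (dvd_prime_pow Polynomial.prime_X _).1 (Dvd.intro q h1)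
  obtain ⟨a, ha, hav⟩ := Polynomial.isUnit_iff.1 (v⁻¹).isUnit
  have h2 : p = Polynomial.C a * Polynomial.X ^ i := by
    rw [hav, ← hv, mul_comm p, ← mul_assoc, Units.inv_mul, one_mul]
  refine ⟨a, i - n, ha, ?_⟩
  rw [T_sub, ← mul_assoc, ← Polynomial.toLaurent_C_mul_X_pow, ← h2, hp, mul_assoc, ← T_add]
  simp

open LaurentPolynomial in
/-- A knot diagram has at most one Conway polynomial. -/
theorem IsConway.unique {D : KnotDiagram} {P Q : Polynomial ℤ} (hP : D.IsConway P)
    (hQ : D.IsConway Q) : P = Q := by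
  obtain ⟨u, hu⟩ := Ideal.span_singleton_eq_span_singleton.1 (hP.2.trans hQ.2.symm)
  obtain ⟨a, k, ha, hak⟩ := exists_eq_of_isUnit u.isUnit
  rw [hak] at hu
  have ev : ∀ (x : ℝˣ) (R : Polynomial ℤ), eval₂ (Int.castRingHom ℝ) x (substZ R) =
      R.eval₂ (Int.castRingHom ℝ) ((x : ℝ) - ((x⁻¹ : ℝˣ) : ℝ)) := by
    intro x R
    induction R using Polynomial.induction_on' with
    | add p q hp hq => simp only [map_add, hp, hq, Polynomial.eval₂_add]
    | monomial n r => simp [substZ, Polynomial.eval₂_monomial]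
  have hx : ∀ x : ℝˣ, P.eval₂ (Int.castRingHom ℝ) ((x : ℝ) - ((x⁻¹ : ℝˣ) : ℝ)) *
      (a * ((x ^ k : ℝˣ) : ℝ)) =
      Q.eval₂ (Int.castRingHom ℝ) ((x : ℝ) - ((x⁻¹ : ℝˣ) : ℝ)) := by
    intro x
    have := congrArg (eval₂ (Int.castRingHom ℝ) x) hu
    rw [map_mul, ev, ev] at this
    simpa using this
  have hc : ∀ R : Polynomial ℤ, R.eval₂ (Int.castRingHom ℝ) 0 = R.coeff 0 := by
    intro R; simp [Polynomial.eval₂_at_zero]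
  have ha1 : a = 1 := by
    have := hx 1
    simp [hc, hP.1, hQ.1] at this
    exact_mod_cast this
  let y : ℕ → ℝˣ := fun n => Units.mk0 ((n : ℝ) + 2) (by positivity)
  let z : ℕ → ℝ := fun n => (y n : ℝ) - (((y n)⁻¹ : ℝˣ) : ℝ)
  have hz : Function.Injective z := by
    refine StrictMono.injective fun i j hij => ?_
    have h1 : (i : ℝ) + 2 < (j : ℝ) + 2 := by exact_mod_cast Nat.add_lt_add_right hij 2
    have h2 : ((j : ℝ) + 2)⁻¹ < ((i : ℝ) + 2)⁻¹ := inv_strictAnti₀ (by positivity) h1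
    simp only [z, y, Units.val_inv_eq_inv_val, Units.val_mk0]
    linarith
  have huniq : ∀ R S : Polynomial ℤ, (∀ n, R.eval₂ (Int.castRingHom ℝ) (z n) =
      S.eval₂ (Int.castRingHom ℝ) (z n)) → R = S := by
    intro R S h
    apply Polynomial.map_injective (Int.castRingHom ℝ) Int.cast_injective
    refine Polynomial.eq_of_infinite_eval_eq _ _
      ((Set.infinite_range_of_injective hz).mono ?_)
    rintro _ ⟨n, rfl⟩
    simpa [Polynomial.eval_map] using h n
  have hk : k = 0 := by
    by_contra hk
    have hP0 : P = 0 := by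
      refine huniq P 0 fun n => ?_
      have h1 := hx (y n)
      have h2 := hx (-(y n)⁻¹)
      have h3 : ((-(y n)⁻¹ : ℝˣ) : ℝ) - (((-(y n)⁻¹)⁻¹ : ℝˣ) : ℝ) = z n := by
        simp [z]; ring
      rw [h3] at h2
      change P.eval₂ _ (z n) * _ = Q.eval₂ _ (z n) at h1
      by_contra h0
      rw [Polynomial.eval₂_zero] at h0
      have h4 := mul_left_cancel₀ h0 (h1.trans h2.symm)
      rw [ha1] at h4
      have h5 := congrArg abs h4
      have hy : (0 : ℝ) < (n : ℝ) + 2 := by positivity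
      simp only [Int.cast_one, one_mul, Units.val_zpow_eq_zpow_val, Units.val_neg,
        Units.val_inv_eq_inv_val, abs_zpow, abs_neg, abs_inv, y, Units.val_mk0,
        abs_of_pos hy, inv_zpow'] at h5
      have h6 := zpow_right_injective₀ hy (by linarith [Nat.cast_nonneg (α := ℝ) n]) h5
      omega
    have := hP.1
    simp [hP0] at this
  refine huniq P Q fun n => ?_
  have := hx (y n)
  rw [hk, ha1] at this
  simpa [z] using this

/-- The Conway polynomial of a knot. -/
noncomputable def conway (D : KnotDiagram) : Polynomial ℤ :=
  open Classical in if h : ∃ P, D.IsConway P then h.choose else 0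

theorem IsConway.conway_eq {D : KnotDiagram} {P : Polynomial ℤ} (h : D.IsConway P) :
    D.conway = P := by
  have h' : ∃ P, D.IsConway P := ⟨P, h⟩
  rw [conway, dif_pos h']
  exact h'.choose_spec.unique h

end KnotDiagram

/-! ### Diagrams made of twisted columns -/

/-- The edges of `k` pairs of strands, where each of the strands `(j, true)` and `(j, false)` is cut
into the edges `0, …, n j` in the order of travel. -/
abbrev ColumnEdge {k : ℕ} (n : Fin k → ℕ) : Type := Σ a : Fin k × Bool, Fin (n a.1 + 1)

theorem ColumnEdge.ext' {k : ℕ} {n : Fin k → ℕ} {a b : Fin k × Bool} {i : Fin (n a.1 + 1)}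
    {j : Fin (n b.1 + 1)} (h : a = b) (h' : i.val = j.val) :
    (⟨a, i⟩ : ColumnEdge n) = ⟨b, j⟩ := by
  subst h
  obtain rfl : i = j := Fin.ext h'
  rfl

/-- The edge after a given edge, if the end of the strand `a` is connected to the start of the
strand `σ a`. -/
def columnNextFun {k : ℕ} (n : Fin k → ℕ) (σ : Equiv.Perm (Fin k × Bool)) (e : ColumnEdge n) :
    ColumnEdge n :=
  if h : e.2.val < n e.1.1 then ⟨e.1, ⟨e.2.val + 1, by omega⟩⟩ else ⟨σ e.1, 0⟩

theorem columnNextFun_of_lt {k : ℕ} {n : Fin k → ℕ} (σ : Equiv.Perm (Fin k × Bool))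
    {a : Fin k × Bool} {i : Fin (n a.1 + 1)} (h : i.val < n a.1) :
    columnNextFun n σ ⟨a, i⟩ = ⟨a, ⟨i.val + 1, by omega⟩⟩ := dif_pos h

theorem columnNextFun_of_not_lt {k : ℕ} {n : Fin k → ℕ} (σ : Equiv.Perm (Fin k × Bool))
    {a : Fin k × Bool} {i : Fin (n a.1 + 1)} (h : ¬ i.val < n a.1) :
    columnNextFun n σ ⟨a, i⟩ = ⟨σ a, 0⟩ := dif_neg h

theorem columnNextFun_injective {k : ℕ} (n : Fin k → ℕ) (σ : Equiv.Perm (Fin k × Bool)) :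
    Function.Injective (columnNextFun n σ) := by
  rintro ⟨a, i⟩ ⟨b, j⟩ h
  by_cases hi : i.val < n a.1 <;> by_cases hj : j.val < n b.1
  · rw [columnNextFun_of_lt σ hi, columnNextFun_of_lt σ hj] at h
    obtain rfl : a = b := congrArg Sigma.fst h
    have h2 := congrArg Fin.val (eq_of_heq (Sigma.mk.inj h).2)
    exact ColumnEdge.ext' rfl (by simpa using h2)
  · rw [columnNextFun_of_lt σ hi, columnNextFun_of_not_lt σ hj] at h
    have h2 := congrArg (fun e : ColumnEdge n => e.2.val) h
    simp at h2
  · rw [columnNextFun_of_not_lt σ hi, columnNextFun_of_lt σ hj] at h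
    have h2 := congrArg (fun e : ColumnEdge n => e.2.val) h
    simp at h2
  · rw [columnNextFun_of_not_lt σ hi, columnNextFun_of_not_lt σ hj] at h
    obtain rfl : a = b := σ.injective (congrArg Sigma.fst h)
    exact ColumnEdge.ext' rfl (by omega)

/-- The map `columnNextFun` as a permutation. -/
noncomputable def columnNext {k : ℕ} (n : Fin k → ℕ) (σ : Equiv.Perm (Fin k × Bool)) :
    Equiv.Perm (ColumnEdge n) :=
  Equiv.ofBijective (columnNextFun n σ) (columnNextFun_injective n σ).bijective_of_finite

/-- A diagram made of `k` vertical columns; the column `j` consists of two antiparallel strands that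
cross each other `n j` times, one crossing below the other.  The strand `(j, true)` runs down and
the strand `(j, false)` runs up through the column; the strand `(j, true)` starts at the upper left
end of the column if `left j` is `true` and at the upper right end otherwise.
Each strand is cut into the edges `0, …, n j`, in the order of travel; the crossing number `i` from
above has the incoming edges `i` of the strand `(j, true)` and `n j - 1 - i` of the strand
`(j, false)`.  All crossings in the column `j` have the sign `ε j`.  With these orientations a crossing
is positive if and only if the strand from the upper left to the lower right is the overpass.
Outside of the columns the end of the strand `a` is connected to the start of the strand `σ a`. -/
noncomputable def columns {k : ℕ} (n : Fin k → ℕ) (ε : Fin k → ℤˣ) (left : Fin k → Bool)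
    (σ : Equiv.Perm (Fin k × Bool)) : GaussData where
  Edge := ColumnEdge n
  Crossing := Σ j : Fin k, Fin (n j)
  next := columnNext n σ
  overIn c :=
    if (Even c.2.val ↔ left c.1 = true) ↔ ε c.1 = 1 then ⟨(c.1, true), c.2.castSucc⟩
    else ⟨(c.1, false), c.2.rev.castSucc⟩
  underIn c :=
    if (Even c.2.val ↔ left c.1 = true) ↔ ε c.1 = 1 then ⟨(c.1, false), c.2.rev.castSucc⟩
    else ⟨(c.1, true), c.2.castSucc⟩
  sign c := ε c.1

namespace columns

variable {k : ℕ} (n : Fin k → ℕ) (ε : Fin k → ℤˣ) (left : Fin k → Bool)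
  (σ : Equiv.Perm (Fin k × Bool))

theorem passages (c : (columns n ε left σ).Crossing) :
    ((columns n ε left σ).overIn c = ⟨(c.1, true), c.2.castSucc⟩ ∧
      (columns n ε left σ).underIn c = ⟨(c.1, false), c.2.rev.castSucc⟩ ∧
      ((Even c.2.val ↔ left c.1 = true) ↔ ε c.1 = 1)) ∨
    ((columns n ε left σ).overIn c = ⟨(c.1, false), c.2.rev.castSucc⟩ ∧
      (columns n ε left σ).underIn c = ⟨(c.1, true), c.2.castSucc⟩ ∧
      ¬((Even c.2.val ↔ left c.1 = true) ↔ ε c.1 = 1)) := by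
  by_cases h : (Even c.2.val ↔ left c.1 = true) ↔ ε c.1 = 1
  · exact Or.inl ⟨if_pos h, if_pos h, h⟩
  · exact Or.inr ⟨if_neg h, if_neg h, h⟩

theorem injective_passage :
    Function.Injective (Sum.elim (columns n ε left σ).overIn (columns n ε left σ).underIn) := by
  have key : ∀ (c d : Σ j : Fin k, Fin (n j)),
      ((⟨(c.1, true), c.2.castSucc⟩ : ColumnEdge n) = ⟨(d.1, true), d.2.castSucc⟩ → c = d) ∧
      ((⟨(c.1, false), c.2.rev.castSucc⟩ : ColumnEdge n) = ⟨(d.1, false), d.2.rev.castSucc⟩ →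
        c = d) ∧
      ((⟨(c.1, true), c.2.castSucc⟩ : ColumnEdge n) ≠ ⟨(d.1, false), d.2.rev.castSucc⟩) := by
    rintro ⟨j, i⟩ ⟨j', i'⟩
    refine ⟨fun h => ?_, fun h => ?_, fun h => ?_⟩
    · obtain rfl : j = j' := congrArg (fun e : ColumnEdge n => e.1.1) h
      have h2 := congrArg (fun e : ColumnEdge n => e.2.val) h
      obtain rfl : i = i' := Fin.ext (by simpa using h2)
      rfl
    · obtain rfl : j = j' := congrArg (fun e : ColumnEdge n => e.1.1) h
      have h2 := congrArg (fun e : ColumnEdge n => e.2.val) h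
      obtain rfl : i = i' := Fin.rev_injective (Fin.ext (by simpa using h2))
      rfl
    · simpa using congrArg (fun e : ColumnEdge n => e.1.2) h
  rintro (c | c) (d | d) h <;> simp only [Sum.elim_inl, Sum.elim_inr] at h <;>
    rcases passages n ε left σ c with ⟨h1, h2, h3⟩ | ⟨h1, h2, h3⟩ <;>
    rcases passages n ε left σ d with ⟨g1, g2, g3⟩ | ⟨g1, g2, g3⟩ <;>
    simp only [h1, h2, g1, g2] at h
  all_goals first
    | exact absurd h (key _ _).2.2
    | exact absurd h.symm (key _ _).2.2
    | (obtain rfl := (key _ _).1 h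
       first | rfl | exact absurd h3 g3 | exact absurd g3 h3)
    | (obtain rfl := (key _ _).2.1 h
       first | rfl | exact absurd h3 g3 | exact absurd g3 h3)

theorem one_component {N : ℕ} (hσ : ∀ a b, ∃ i < N, σ^[i] a = b) :
    (columns n ε left σ).next.IsCycleOn Set.univ := by
  have step : ∀ (a : Fin k × Bool) (i : ℕ) (h : i < n a.1 + 1),
      (columnNext n σ).SameCycle ⟨a, 0⟩ ⟨a, ⟨i, h⟩⟩ := by
    intro a i
    induction i with
    | zero => intro h; exact Equiv.Perm.SameCycle.refl _ _
    | succ i ih =>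
      intro h
      have h1 := Equiv.Perm.sameCycle_apply_right.2 (ih (by omega))
      have h2 : columnNext n σ ⟨a, ⟨i, by omega⟩⟩ = ⟨a, ⟨i + 1, h⟩⟩ :=
        columnNextFun_of_lt σ (by simp only []; omega)
      rwa [h2] at h1
  have link : ∀ a : Fin k × Bool, (columnNext n σ).SameCycle ⟨a, 0⟩ ⟨σ a, 0⟩ := by
    intro a
    have h1 := Equiv.Perm.sameCycle_apply_right.2 (step a (n a.1) (by omega))
    have h2 : columnNext n σ ⟨a, ⟨n a.1, by omega⟩⟩ = ⟨σ a, 0⟩ :=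
      columnNextFun_of_not_lt σ (by simp)
    rwa [h2] at h1
  have links : ∀ (i : ℕ) (a : Fin k × Bool),
      (columnNext n σ).SameCycle ⟨a, 0⟩ ⟨σ^[i] a, 0⟩ := by
    intro i
    induction i with
    | zero => intro a; exact Equiv.Perm.SameCycle.refl _ _
    | succ i ih => intro a; exact (link a).trans (ih (σ a))
  refine ⟨Set.bijOn_univ.2 (Equiv.bijective _), ?_⟩
  rintro ⟨a, i⟩ - ⟨b, j⟩ -
  obtain ⟨m, -, rfl⟩ := hσ a b
  exact ((step a i i.2).symm.trans (links m a)).trans (step _ j j.2)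

theorem isPlain_iff (e : ColumnEdge n) (h : (columns n ε left σ).IsPlain e) :
    ¬ e.2.val < n e.1.1 := by
  obtain ⟨⟨j, b⟩, i⟩ := e
  intro hi
  cases b with
  | true =>
    let c : (columns n ε left σ).Crossing := ⟨j, ⟨i.val, hi⟩⟩
    rcases passages n ε left σ c with ⟨h1, h2, -⟩ | ⟨h1, h2, -⟩
    · exact (h c).1 h1
    · exact (h c).2 h2
  | false =>
    let c : (columns n ε left σ).Crossing := ⟨j, Fin.rev ⟨i.val, hi⟩⟩
    have hc : (⟨(c.1, false), c.2.rev.castSucc⟩ : ColumnEdge n) = ⟨(j, false), i⟩ :=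
      ColumnEdge.ext' rfl (by simp [c])
    rcases passages n ε left σ c with ⟨h1, h2, -⟩ | ⟨h1, h2, -⟩
    · exact (h c).2 (h2.trans hc)
    · exact (h c).1 (h1.trans hc)

/-- The region to the right of a dart, where `(j, b)` is the strand, `v` the level counted from above
and `d` the direction of the dart.  Here `lev j v` is the region between the two strands of the
column `j` at the level `v`, and `side j true` and `side j false` are the regions to the left and to
the right of the column `j`. -/
def region {F : Type} (lev : Fin k → ℕ → F) (side : Fin k → Bool → F) (j : Fin k) (b : Bool)
    (v : ℕ) (d : Bool) : F :=
  if d = true ↔ ¬(left j = true ↔ Even v) then lev j v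
  else side j (decide (b = true ↔ (left j = true ↔ Even v)))

/-- An edge and a direction are sent to the region to the right. -/
def dartRegion {F : Type} (lev : Fin k → ℕ → F) (side : Fin k → Bool → F)
    (e : ColumnEdge n) (d : Bool) : F :=
  region left lev side e.1.1 e.1.2 (if e.1.2 then e.2.val else n e.1.1 - e.2.val) d

theorem planar {F : Type} [Fintype F] (lev : Fin k → ℕ → F) (side : Fin k → Bool → F)
    (hσ : ∀ a d, region left lev side a.1 a.2 (if a.2 then n a.1 else 0) d =
      region left lev side (σ a).1 (σ a).2 (if (σ a).2 then 0 else n (σ a).1) d)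
    (hF : ∀ f, (∃ j v, v ≤ n j ∧ lev j v = f) ∨ ∃ j b, side j b = f)
    (hcard : Fintype.card F = ∑ j, n j + 2) :
    Fintype.card (columns n ε left σ).Crossing + 2 ≤ Nat.card (columns n ε left σ).Face := by
  let D := columns n ε left σ
  let f : D.Edge → Bool → F := fun e d => dartRegion n left lev side e d
  let R : D.Crossing → Bool → ℕ → Bool → F := fun c b v d => region left lev side c.1 b v d
  have hx : ∀ (c : D.Crossing) (d : Bool),
      f ⟨(c.1, true), c.2.castSucc⟩ d = R c true c.2.val d := fun c d => rfl
  have hy : ∀ (c : D.Crossing) (d : Bool),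
      f ⟨(c.1, false), c.2.rev.castSucc⟩ d = R c false (c.2.val + 1) d := by
    intro c d
    have : n c.1 - (n c.1 - (c.2.val + 1)) = c.2.val + 1 := by have := c.2.2; omega
    simp [f, R, dartRegion, this]
  have hx' : ∀ (c : D.Crossing) (d : Bool),
      f (D.next ⟨(c.1, true), c.2.castSucc⟩) d = R c true (c.2.val + 1) d := by
    intro c d
    have h : D.next ⟨(c.1, true), c.2.castSucc⟩ =
        ⟨(c.1, true), ⟨c.2.val + 1, by simp⟩⟩ := columnNextFun_of_lt σ (by simp)
    rw [h]; rfl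
  have hy' : ∀ (c : D.Crossing) (d : Bool),
      f (D.next ⟨(c.1, false), c.2.rev.castSucc⟩) d = R c false c.2.val d := by
    intro c d
    have h : D.next ⟨(c.1, false), c.2.rev.castSucc⟩ =
        ⟨(c.1, false), ⟨c.2.rev.val + 1, by have := c.2.rev.2; simp only []; omega⟩⟩ :=
      columnNextFun_of_lt σ (by have := c.2.rev.2; simp only [Fin.val_castSucc]; omega)
    have : n c.1 - (n c.1 - (c.2.val + 1) + 1) = c.2.val := by have := c.2.2; omega
    rw [h]
    simp [f, R, dartRegion, this]
  have hp : ∀ (e : D.Edge) (d : Bool), D.IsPlain e → f e d = f (D.next e) d := by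
    intro e d he
    have h := isPlain_iff n ε left σ e he
    obtain ⟨a, i⟩ := e
    have h1 : D.next ⟨a, i⟩ = ⟨σ a, 0⟩ := columnNextFun_of_not_lt σ h
    have h2 : i.val = n a.1 := by simp only [] at h; omega
    rw [h1]
    have := hσ a d
    simpa [f, dartRegion, h2] using this
  have hu : (1 : ℤˣ) ≠ -1 := by decide
  have hstep : ∀ x y, D.FaceStep x y → f x.1 x.2 = f y.1 y.2 := by
    have sg : ∀ c, D.sign c = ε c.1 := fun _ => rfl
    intro x y h
    cases h with
    | plain_forward e h => exact hp e true h
    | plain_backward e h => exact (hp e false h).symm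
    | _ c h =>
      rw [sg] at h
      rcases passages n ε left σ c with ⟨h1, h2, h3⟩ | ⟨h1, h2, h3⟩ <;>
      rw [h] at h3 <;>
      simp only [D, h1, h2] <;>
      simp only [D] at hx hy hx' hy' <;>
      simp only [hx, hy, hx', hy'] <;>
      clear hx hy hx' hy' hp hσ hF hcard <;>
      simp only [hu.symm, iff_true, iff_false] at h3 <;>
      by_cases hE : Even c.2.val <;> cases hl : left c.1 <;>
      simp [hE, hl] at h3 <;>
      simp [R, region, Nat.even_add_one, hE, hl]
  let φ : (columns n ε left σ).Face → F := Quot.lift (fun x => f x.1 x.2) hstep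
  have hφ : Function.Surjective φ := by
    intro f
    rcases hF f with ⟨j, v, hv, rfl⟩ | ⟨j, b, rfl⟩
    · refine ⟨Quot.mk _ (⟨(j, true), ⟨v, Nat.lt_succ_of_le hv⟩⟩,
        decide (¬(left j = true ↔ Even v))), ?_⟩
      by_cases hE : Even v <;> cases hl : left j <;> simp [φ, f, dartRegion, region, hE, hl]
    · refine ⟨Quot.mk _ (⟨(j, decide (b = left j)), if b = left j then 0 else Fin.last _⟩,
        decide (left j = true)), ?_⟩
      cases b <;> cases hl : left j <;> simp [φ, f, dartRegion, region, hl]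
  have : Finite (columns n ε left σ).Face :=
    inferInstanceAs (Finite (Quot (columns n ε left σ).FaceStep))
  have h1 := Nat.card_le_card_of_surjective φ hφ
  rw [Nat.card_eq_fintype_card, hcard] at h1
  have h2 : Fintype.card (columns n ε left σ).Crossing = ∑ j, n j := by
    change Fintype.card (Σ j : Fin k, Fin (n j)) = _
    simp
  omega

end columns

/-- The double twist knot `J(ℓ, m)` for even `ℓ` and `m`.  The column `0` contains `|ℓ|` half twists.
The column `1`, which contains `|m|` half twists, is turned by a quarter turn counterclockwise, so that
its upper end points to the left, and is placed below the column `0`.  The lower left (right) end of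
the column `0` is connected to the nearest end, the upper left (right) one, of the horizontal
column `1`, and the upper left (right) end of the column `0` to the lower left (right) one of it,
by arcs around the left (right) of the diagram.
For `ℓ > 0` the crossings in the column `0` are negative and for `ℓ < 0` they are positive, and
likewise for `m` and the column `1`.  So `J(2, 2)` is the left-handed trefoil, and `J(2, -2)` is the
figure-eight knot. -/
noncomputable def doubleTwistKnot (ℓ m : ℤ) (hℓ : Even ℓ) (hm : Even m) : KnotDiagram where
  toGaussData := columns ![ℓ.natAbs, m.natAbs]
    ![if 0 < ℓ then -1 else 1, if 0 < m then -1 else 1] ![true, false]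
    { toFun := fun a => (a.1 + 1, if a.1 = 0 then a.2 else !a.2)
      invFun := fun a => (a.1 + 1, if a.1 = 1 then a.2 else !a.2)
      left_inv := by unfold Function.LeftInverse; decide
      right_inv := by unfold Function.RightInverse Function.LeftInverse; decide }
  nonempty_edge := ⟨⟨(0, true), 0⟩⟩
  injective_passage := columns.injective_passage _ _ _ _
  one_component := columns.one_component (N := 4) _ _ _ _ (by decide)
  planar := by
    have hℓ' : Even ℓ.natAbs := Int.natAbs_even.2 hℓ
    have hm' : Even m.natAbs := Int.natAbs_even.2 hm
    refine columns.planar (F := Fin (ℓ.natAbs + 1) ⊕ Fin (m.natAbs + 1)) _ _ _ _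
      (fun j v => if j = 0 then .inl (Fin.ofNat _ v) else .inr (Fin.ofNat _ v))
      (fun j b => if j = 0 then .inr (if b then 0 else Fin.last _)
        else .inl (if b then 0 else Fin.last _)) ?_ ?_ ?_
    · rintro ⟨j, b⟩ d
      fin_cases j <;> cases b <;> cases d <;>
        simp [columns.region, hℓ', hm', Fin.last, Fin.ofNat]
    · rintro (f | f)
      · exact Or.inl ⟨0, f.val, by simp; omega, by simp⟩
      · exact Or.inl ⟨1, f.val, by simp; omega, by simp⟩
    · simp [Fin.sum_univ_two]; omega

/-- The pretzel knot `P(p, q, r)` for odd `p, q, r > 0`.  There are three columns, from left to right,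
with `p`, `q` and `r` half twists; every upper (lower) right end is connected to the upper (lower) left
end of the next column, and the upper (lower) right end of the last column to the upper (lower) left
end of the first one.  All crossings are positive, so that `P(1, 1, 1)` is the right-handed
trefoil. -/
noncomputable def pretzelKnot (p q r : ℕ) (hp : Odd p) (hq : Odd q) (hr : Odd r) :
    KnotDiagram where
  toGaussData := columns ![p, q, r] (fun _ => 1) (fun _ => true)
    { toFun := fun a => (a.1 + 1, !a.2)
      invFun := fun a => (a.1 - 1, !a.2)
      left_inv := by unfold Function.LeftInverse; decide
      right_inv := by unfold Function.RightInverse Function.LeftInverse; decide }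
  nonempty_edge := ⟨⟨(0, true), 0⟩⟩
  injective_passage := columns.injective_passage _ _ _ _
  one_component := columns.one_component (N := 6) _ _ _ _ (by decide)
  planar := by
    have hn : ∀ j : Fin 3, Odd (![p, q, r] j) := by
      intro j; fin_cases j <;> assumption
    have hE : ∀ j : Fin 3, ¬ Even (![p, q, r] j) := fun j => Nat.not_even_iff_odd.2 (hn j)
    have h0 : ∀ j : Fin 3, ![p, q, r] j ≠ 0 := fun j h => by
      have := (hn j).pos; omega
    refine columns.planar (F := (Σ j : Fin 3, Fin (![p, q, r] j - 1)) ⊕ (Bool ⊕ Fin 3)) _ _ _ _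
      (fun j v => if hv : v = 0 then .inr (.inl true) else
        if h : v < ![p, q, r] j then .inl ⟨j, ⟨v - 1, by omega⟩⟩ else .inr (.inl false))
      (fun j b => .inr (.inr (if b then j else j + 1))) ?_ ?_ ?_
    · rintro ⟨j, b⟩ d
      cases b <;> cases d <;>
        simp [columns.region, hE, h0]
    · rintro (⟨j, i⟩ | b | j)
      · refine Or.inl ⟨j, i.val + 1, by omega, ?_⟩
        have : i.val + 1 < ![p, q, r] j := by omega
        simp [this]
      · cases b with
        | true => exact Or.inl ⟨0, 0, by simp, by simp⟩
        | false => exact Or.inl ⟨0, p, by simp, by have := h0 0; simp at this; simp [this]⟩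
      · exact Or.inr ⟨j, true, by simp⟩
    · have := hp.pos; have := hq.pos; have := hr.pos
      simp [Fin.sum_univ_three]; omega

/-!
Both families are built from columns of crossings, and both invariants can be computed column by
column.

*Conway polynomial.*  The ideal of the entries of the adjugate of a matrix does not change when
unknowns are eliminated.  The Wirtinger relations of a column can be solved from top to bottom,
which leaves two generators and two relations for each column.  Eliminating half of these
generators, one is left with a `2 × 2` or `3 × 3` matrix whose adjugate has the Alexander
polynomial as its only entry up to sign.

*Jones polynomial.*  Smooth every crossing of a column.  If `c ≥ 1` crossings are smoothed
according to the orientation, the column becomes an arc above, an arc below and `c - 1` circles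
between them; otherwise it becomes two vertical strands.  The state sum of a column is thus a
binomial sum, the Jones polynomial is a sum over the `2 ^ k` patterns of `k` columns, and `v₃` is
read off from its third order jet at `1`.
-/

section AdjugateIdeal

open Matrix

variable {R : Type*} [CommRing R] {m X Y : Type*} [Fintype m] [DecidableEq m]
  [Fintype X] [DecidableEq X] [Fintype Y] [DecidableEq Y]

/-- The ideal generated by the minors of codimension one of a square matrix, which up to sign are
the entries of its adjugate. -/
def adjugateIdeal (M : Matrix m m R) : Ideal R :=
  Ideal.span (Set.range fun ij : m × m => M.adjugate ij.1 ij.2)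

theorem adjugate_mem_adjugateIdeal (M : Matrix m m R) (i j : m) :
    M.adjugate i j ∈ adjugateIdeal M :=
  Ideal.subset_span ⟨(i, j), rfl⟩

theorem adjugateIdeal_le {M : Matrix m m R} {I : Ideal R} (h : ∀ i j, M.adjugate i j ∈ I) :
    adjugateIdeal M ≤ I :=
  Ideal.span_le.2 (Set.range_subset_iff.2 fun ij => h ij.1 ij.2)

theorem adjugateIdeal_eq_span_singleton [Nonempty m] {M : Matrix m m R} {a : R}
    (h : ∀ i j, M.adjugate i j = a) : adjugateIdeal M = Ideal.span {a} := by
  simp only [adjugateIdeal, h, Set.range_const]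

theorem det_mem_adjugateIdeal [Nonempty m] (M : Matrix m m R) : M.det ∈ adjugateIdeal M := by
  inhabit m
  have h : M.det = (M * M.adjugate) default default := by simp [mul_adjugate]
  rw [h, mul_apply]
  exact Ideal.sum_mem _ fun i _ => Ideal.mul_mem_left _ _ (adjugate_mem_adjugateIdeal _ _ _)

theorem adjugateIdeal_mul_le_left (A B : Matrix m m R) :
    adjugateIdeal (A * B) ≤ adjugateIdeal A := by
  refine adjugateIdeal_le fun i j => ?_
  rw [adjugate_mul_distrib, mul_apply]
  exact Ideal.sum_mem _ fun z _ => Ideal.mul_mem_left _ _ (adjugate_mem_adjugateIdeal _ _ _)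

theorem adjugateIdeal_mul_le_right (A B : Matrix m m R) :
    adjugateIdeal (A * B) ≤ adjugateIdeal B := by
  refine adjugateIdeal_le fun i j => ?_
  rw [adjugate_mul_distrib, mul_apply]
  exact Ideal.sum_mem _ fun z _ => Ideal.mul_mem_right _ _ (adjugate_mem_adjugateIdeal _ _ _)

theorem adjugateIdeal_isUnit_mul {P : Matrix m m R} (hP : IsUnit P) (M : Matrix m m R) :
    adjugateIdeal (P * M) = adjugateIdeal M := by
  obtain ⟨u, rfl⟩ := hP
  refine le_antisymm (adjugateIdeal_mul_le_right _ _) ?_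
  simpa using adjugateIdeal_mul_le_right (↑u⁻¹ : Matrix m m R) (u * M)

theorem adjugateIdeal_mul_isUnit {Q : Matrix m m R} (hQ : IsUnit Q) (M : Matrix m m R) :
    adjugateIdeal (M * Q) = adjugateIdeal M := by
  obtain ⟨u, rfl⟩ := hQ
  refine le_antisymm (adjugateIdeal_mul_le_left _ _) ?_
  simpa using adjugateIdeal_mul_le_left (M * (u : Matrix m m R)) (↑u⁻¹ : Matrix m m R)

theorem adjugateIdeal_submatrix_equiv_self (e : X ≃ m) (M : Matrix m m R) :
    adjugateIdeal (M.submatrix e e) = adjugateIdeal M := by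
  have h : (fun ij : X × X => (M.submatrix e e).adjugate ij.1 ij.2) =
      (fun ij : m × m => M.adjugate ij.1 ij.2) ∘ e.prodCongr e := by
    simp only [adjugate_submatrix_equiv_self]
    rfl
  rw [adjugateIdeal, h, (e.prodCongr e).surjective.range_comp, adjugateIdeal]

theorem adjugateIdeal_submatrix_equiv (r c : X ≃ m) (M : Matrix m m R) :
    adjugateIdeal (M.submatrix r c) = adjugateIdeal M := by
  have h : M.submatrix r c = M.submatrix r r * (1 : Matrix m m R).submatrix r c := by
    rw [submatrix_mul_equiv, Matrix.mul_one]
  rw [h, adjugateIdeal_mul_isUnit ((isUnit_submatrix_equiv r c).2 isUnit_one),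
    adjugateIdeal_submatrix_equiv_self]

theorem det_updateRow_inl_fromBlocks (A : Matrix X X R) (B : Matrix X Y R) (D : Matrix Y Y R)
    (i : X) (v : X ⊕ Y → R) :
    ((fromBlocks A B 0 D).updateRow (Sum.inl i) v).det =
      (A.updateRow i (v ∘ Sum.inl)).det * D.det := by
  have h : (fromBlocks A B 0 D).updateRow (Sum.inl i) v =
      fromBlocks (A.updateRow i (v ∘ Sum.inl)) (B.updateRow i (v ∘ Sum.inr)) 0 D := by
    ext (_ | _) (_ | _) <;> simp [updateRow_apply]
  rw [h, det_fromBlocks_zero₂₁]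

theorem det_updateRow_inr_fromBlocks (A : Matrix X X R) (C : Matrix Y X R) (D : Matrix Y Y R)
    (i : Y) (v : X ⊕ Y → R) :
    ((fromBlocks A 0 C D).updateRow (Sum.inr i) v).det =
      A.det * (D.updateRow i (v ∘ Sum.inr)).det := by
  have h : (fromBlocks A 0 C D).updateRow (Sum.inr i) v =
      fromBlocks A 0 (C.updateRow i (v ∘ Sum.inl)) (D.updateRow i (v ∘ Sum.inr)) := by
    ext (_ | _) (_ | _) <;> simp [updateRow_apply]
  rw [h, det_fromBlocks_zero₁₂]

theorem adjugate_fromBlocks_diagonal (A : Matrix X X R) (D : Matrix Y Y R) :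
    (fromBlocks A 0 0 D).adjugate = fromBlocks (D.det • A.adjugate) 0 0 (A.det • D.adjugate) := by
  ext (i | i) (j | j)
  · have h : (Pi.single (Sum.inl i) 1 : X ⊕ Y → R) ∘ Sum.inl = Pi.single i 1 :=
      funext fun _ => by simp [Pi.single_apply]
    simp [adjugate_apply, det_updateRow_inl_fromBlocks, h, mul_comm]
  · simp [adjugate_apply, det_updateRow_inr_fromBlocks, det_eq_zero_of_row_eq_zero j]
  · simp [adjugate_apply, det_updateRow_inl_fromBlocks, det_eq_zero_of_row_eq_zero j]
  · have h : (Pi.single (Sum.inr i) 1 : X ⊕ Y → R) ∘ Sum.inr = Pi.single i 1 :=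
      funext fun _ => by simp [Pi.single_apply]
    simp [adjugate_apply, det_updateRow_inr_fromBlocks, h]

theorem adjugateIdeal_fromBlocks_one [Nonempty Y] (S : Matrix Y Y R) :
    adjugateIdeal (fromBlocks (1 : Matrix X X R) 0 0 S) = adjugateIdeal S := by
  have h : (fromBlocks (1 : Matrix X X R) 0 0 S).adjugate =
      fromBlocks (S.det • 1) 0 0 S.adjugate := by
    rw [adjugate_fromBlocks_diagonal, adjugate_one, det_one, one_smul]
  refine le_antisymm (adjugateIdeal_le fun i j => ?_) (adjugateIdeal_le fun i j => ?_)
  · rw [h]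
    rcases i with i | i <;> rcases j with j | j
    · exact Ideal.mul_mem_right _ _ (det_mem_adjugateIdeal S)
    · exact zero_mem _
    · exact zero_mem _
    · exact adjugate_mem_adjugateIdeal S i j
  · simpa only [h, fromBlocks_apply₂₂] using
      adjugate_mem_adjugateIdeal (fromBlocks (1 : Matrix X X R) 0 0 S) (Sum.inr i) (Sum.inr j)

theorem adjugateIdeal_fromBlocks [Nonempty Y] {A : Matrix X X R} {B W : Matrix X Y R}
    (hA : IsUnit A) (hW : A * W + B = 0) (C : Matrix Y X R) (D : Matrix Y Y R) :
    adjugateIdeal (fromBlocks A B C D) = adjugateIdeal (C * W + D) := by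
  have hQ : IsUnit (fromBlocks (1 : Matrix X X R) W 0 (1 : Matrix Y Y R)) := by
    simp [isUnit_iff_isUnit_det]
  have hP : IsUnit (fromBlocks A 0 C (1 : Matrix Y Y R)) := by
    simpa [isUnit_iff_isUnit_det] using (isUnit_iff_isUnit_det A).1 hA
  have h : fromBlocks A B C D * fromBlocks 1 W 0 1 =
      fromBlocks A 0 C 1 * fromBlocks 1 0 0 (C * W + D) := by
    simp [fromBlocks_multiply, hW]
  rw [← adjugateIdeal_mul_isUnit hQ, h, adjugateIdeal_isUnit_mul hP, adjugateIdeal_fromBlocks_one]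

/-- Elimination of unknowns: the equations `r (inl x)` determine the unknowns `c (inl x)`, and `E y`
is their solution with prescribed values `y` of the unknowns `c (inr i)`. -/
theorem adjugateIdeal_eq_of_solution {Z : Type*} [Nonempty Y] (M : Matrix m m R)
    (r c : Z ⊕ Y ≃ m)
    (E : (Y → R) → m → R) (hE : ∀ y i, E y (c (Sum.inr i)) = y i)
    (h0 : ∀ y x, (M *ᵥ E y) (r (Sum.inl x)) = 0)
    (hA : ∀ w : Z → R, ∃ z : m → R, (∀ i, z (c (Sum.inr i)) = 0) ∧
      ∀ x, (M *ᵥ z) (r (Sum.inl x)) = w x) :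
    adjugateIdeal M =
      adjugateIdeal (of fun i y => (M *ᵥ E (Pi.single y 1)) (r (Sum.inr i))) := by
  classical
  have := Fintype.ofInjective _ (r.injective.comp Sum.inl_injective)
  have hmul : ∀ z i, (M *ᵥ z) i = ∑ x, M i (c (Sum.inl x)) * z (c (Sum.inl x)) +
      ∑ y, M i (c (Sum.inr y)) * z (c (Sum.inr y)) := fun z i => by
    rw [mulVec, dotProduct, ← c.sum_comp, Fintype.sum_sum_type]
  have hE' : ∀ y i, (M *ᵥ E (Pi.single y 1)) i =
      ∑ x, M i (c (Sum.inl x)) * E (Pi.single y 1) (c (Sum.inl x)) + M i (c (Sum.inr y)) :=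
    fun y i => by simp [hmul, hE, Pi.single_apply]
  let W : Matrix Z Y R := of fun x y => E (Pi.single y 1) (c (Sum.inl x))
  have hunit : IsUnit (M.submatrix r c).toBlocks₁₁ := by
    refine mulVec_surjective_iff_isUnit.1 fun w => ?_
    obtain ⟨z, hz, hw⟩ := hA w
    refine ⟨fun x => z (c (Sum.inl x)), funext fun x => ?_⟩
    rw [← hw x, hmul]
    simp [hz, toBlocks₁₁, mulVec, dotProduct]
  have hW : (M.submatrix r c).toBlocks₁₁ * W + (M.submatrix r c).toBlocks₁₂ = 0 := by
    ext x y
    simpa [hE', toBlocks₁₁, toBlocks₁₂, mul_apply, W] using h0 (Pi.single y 1) x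
  rw [← adjugateIdeal_submatrix_equiv r c, ← fromBlocks_toBlocks (M.submatrix r c),
    adjugateIdeal_fromBlocks hunit hW]
  congr 1
  ext i y
  simp [hE', toBlocks₂₁, toBlocks₂₂, mul_apply, W]

end AdjugateIdeal

namespace KnotDiagram

open Matrix

theorem alexanderMatrix_mulVec (D : KnotDiagram) (x : D.Edge → ℤ[T;T⁻¹]) (e : D.Edge) :
    (D.alexanderMatrix *ᵥ x) e = x (D.next e) - x e + ∑ c : D.Crossing,
      if D.underIn c = e then
        (1 - LaurentPolynomial.T (-(D.sign c : ℤ))) * (x (D.underIn c) - x (D.overIn c))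
      else 0 := by
  have hsingle : ∀ a b : D.Edge,
      (Matrix.single a b (1 : ℤ[T;T⁻¹]) *ᵥ x) e = if a = e then x b else 0 := by
    intro a b
    by_cases h : a = e <;> simp [mulVec, dotProduct, Matrix.single_apply, h]
  rw [alexanderMatrix, Matrix.add_mulVec, Pi.add_apply, Matrix.sum_mulVec, Finset.sum_apply]
  congr 1
  · simp [mulVec, dotProduct, sub_mul, Finset.sum_sub_distrib]
  · refine Finset.sum_congr rfl fun c _ => ?_
    rw [Matrix.smul_mulVec, Pi.smul_apply, Matrix.sub_mulVec, Pi.sub_apply, hsingle, hsingle]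
    split_ifs <;> simp

theorem alexanderMatrix_mulVec_underIn (D : KnotDiagram) (x : D.Edge → ℤ[T;T⁻¹])
    (c : D.Crossing) :
    (D.alexanderMatrix *ᵥ x) (D.underIn c) = x (D.next (D.underIn c)) - x (D.underIn c) +
      (1 - LaurentPolynomial.T (-(D.sign c : ℤ))) * (x (D.underIn c) - x (D.overIn c)) := by
  have hinj : Function.Injective D.underIn := D.injective_passage.comp Sum.inr_injective
  simp [alexanderMatrix_mulVec, hinj.eq_iff]

theorem alexanderMatrix_mulVec_of_forall_ne (D : KnotDiagram) (x : D.Edge → ℤ[T;T⁻¹])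
    {e : D.Edge} (h : ∀ c, D.underIn c ≠ e) :
    (D.alexanderMatrix *ᵥ x) e = x (D.next e) - x e := by
  simp [alexanderMatrix_mulVec, h]

theorem alexanderMatrix_mulVec_overIn (D : KnotDiagram) (x : D.Edge → ℤ[T;T⁻¹])
    (c : D.Crossing) :
    (D.alexanderMatrix *ᵥ x) (D.overIn c) = x (D.next (D.overIn c)) - x (D.overIn c) :=
  D.alexanderMatrix_mulVec_of_forall_ne x fun d h => by
    simpa using D.injective_passage (a₁ := Sum.inr d) (a₂ := Sum.inl c) h

end KnotDiagram

namespace ColumnEdge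

variable {k : ℕ} {n : Fin k → ℕ}

/-- The edge of the strand `(j, b)` at the level `v`, where levels are counted from above, also for
the strands that run up. -/
def atLevel (j : Fin k) (b : Bool) (v : Fin (n j + 1)) : ColumnEdge n :=
  ⟨(j, b), if b then v else v.rev⟩

/-- The level of an edge, counted from above. -/
def level (e : ColumnEdge n) : Fin (n e.1.1 + 1) := if e.1.2 then e.2 else e.2.rev

theorem atLevel_level (e : ColumnEdge n) : atLevel e.1.1 e.1.2 e.level = e := by
  obtain ⟨⟨j, b⟩, i⟩ := e
  cases b <;> simp [atLevel, level]

@[simp]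
theorem level_atLevel (j : Fin k) (b : Bool) (v : Fin (n j + 1)) :
    level (atLevel j b v) = v := by
  cases b <;> simp [atLevel, level]

theorem exists_eq_atLevel (e : ColumnEdge n) : ∃ j b v, e = atLevel j b v :=
  ⟨_, _, _, (atLevel_level e).symm⟩

/-- The first edge of a strand. -/
def start (a : Fin k × Bool) : ColumnEdge n := ⟨a, 0⟩

/-- The last edge of a strand. -/
def finish (a : Fin k × Bool) : ColumnEdge n := ⟨a, Fin.last _⟩

theorem start_eq (a : Fin k × Bool) :
    (start a : ColumnEdge n) = atLevel a.1 a.2 (if a.2 then 0 else Fin.last _) := by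
  obtain ⟨j, b⟩ := a
  cases b <;> simp [start, atLevel]

theorem finish_eq (a : Fin k × Bool) :
    (finish a : ColumnEdge n) = atLevel a.1 a.2 (if a.2 then Fin.last _ else 0) := by
  obtain ⟨j, b⟩ := a
  cases b <;> simp [finish, atLevel]

/-- The edge of the strand `(c.1, b)` that runs into the crossing `c`. -/
def incoming (c : Σ j : Fin k, Fin (n j)) (b : Bool) : ColumnEdge n :=
  atLevel c.1 b (if b then c.2.castSucc else c.2.succ)

/-- The edge of the strand `(c.1, b)` that leaves the crossing `c`. -/
def outgoing (c : Σ j : Fin k, Fin (n j)) (b : Bool) : ColumnEdge n :=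
  atLevel c.1 b (if b then c.2.succ else c.2.castSucc)

theorem columnNext_incoming (σ : Equiv.Perm (Fin k × Bool)) (c : Σ j : Fin k, Fin (n j))
    (b : Bool) : columnNext n σ (incoming c b) = outgoing c b := by
  obtain ⟨j, i⟩ := c
  refine (columnNextFun_of_lt σ ?_).trans (ColumnEdge.ext' rfl ?_) <;> cases b <;>
    simp only [Bool.false_eq_true, if_true, if_false, Fin.rev_succ, Fin.rev_castSucc,
      Fin.val_castSucc, Fin.val_succ] <;> omega

theorem columnNext_finish (σ : Equiv.Perm (Fin k × Bool)) (a : Fin k × Bool) :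
    columnNext n σ (finish a) = start (σ a) :=
  columnNextFun_of_not_lt σ (by simp)

/-- Every edge either runs into a crossing or is the last edge of a strand. -/
noncomputable def headEquiv (n : Fin k → ℕ) :
    ((Σ j : Fin k, Fin (n j)) × Bool) ⊕ (Fin k × Bool) ≃ ColumnEdge n :=
  Equiv.ofBijective (Sum.elim (fun x => incoming x.1 x.2) finish) <| by
    rw [Fintype.bijective_iff_surjective_and_card]
    constructor
    · intro e
      obtain ⟨j, b, v, rfl⟩ := exists_eq_atLevel e
      cases b
      · induction v using Fin.cases with
        | zero => exact ⟨Sum.inr (j, false), by simp [finish_eq]⟩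
        | succ i => exact ⟨Sum.inl (⟨j, i⟩, false), rfl⟩
      · induction v using Fin.lastCases with
        | last => exact ⟨Sum.inr (j, true), by simp [finish_eq]⟩
        | cast i => exact ⟨Sum.inl (⟨j, i⟩, true), rfl⟩
    · simp [Fintype.sum_prod_type, Finset.sum_add_distrib, mul_two, two_mul]

/-- Every edge either lies directly below a crossing or at the top of a column. -/
noncomputable def levelEquiv (n : Fin k → ℕ) :
    ((Σ j : Fin k, Fin (n j)) × Bool) ⊕ (Fin k × Bool) ≃ ColumnEdge n :=
  Equiv.ofBijective
    (Sum.elim (fun x => atLevel x.1.1 x.2 x.1.2.succ) (fun a => atLevel a.1 a.2 0)) <| by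
    rw [Fintype.bijective_iff_surjective_and_card]
    constructor
    · intro e
      obtain ⟨j, b, v, rfl⟩ := exists_eq_atLevel e
      induction v using Fin.cases with
      | zero => exact ⟨Sum.inr (j, b), rfl⟩
      | succ i => exact ⟨Sum.inl (⟨j, i⟩, b), rfl⟩
    · simp [Fintype.sum_prod_type, Finset.sum_add_distrib, mul_two, two_mul]

theorem incoming_ne_finish (c : Σ j : Fin k, Fin (n j)) (b : Bool) (a : Fin k × Bool) :
    incoming c b ≠ finish a := fun h =>
  Sum.inl_ne_inr ((headEquiv n).injective (a₁ := Sum.inl (c, b)) (a₂ := Sum.inr a) h)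

end ColumnEdge

namespace columns

open ColumnEdge

variable {k : ℕ} {n : Fin k → ℕ} {ε : Fin k → ℤˣ} {left : Fin k → Bool}
  {σ : Equiv.Perm (Fin k × Bool)}

/-- The direction (`true` for down) of the strand that passes over at the crossing number `i` of the
column `j`. -/
def overStrand (ε : Fin k → ℤˣ) (left : Fin k → Bool) (j : Fin k) (i : ℕ) : Bool :=
  decide ((Even i ↔ left j = true) ↔ ε j = 1)

theorem overIn_eq (c : Σ j : Fin k, Fin (n j)) :
    (columns n ε left σ).overIn c = incoming c (overStrand ε left c.1 c.2) := by
  by_cases h : (Even c.2.val ↔ left c.1 = true) ↔ ε c.1 = 1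
  · simp [columns, h, overStrand, incoming, atLevel]
  · simp [columns, h, overStrand, incoming, atLevel, Fin.rev_succ]

theorem underIn_eq (c : Σ j : Fin k, Fin (n j)) :
    (columns n ε left σ).underIn c = incoming c (!overStrand ε left c.1 c.2) := by
  by_cases h : (Even c.2.val ↔ left c.1 = true) ↔ ε c.1 = 1
  · simp [columns, h, overStrand, incoming, atLevel, Fin.rev_succ]
  · simp [columns, h, overStrand, incoming, atLevel]

theorem next_incoming (c : Σ j : Fin k, Fin (n j)) (b : Bool) :
    (columns n ε left σ).next (incoming c b) = outgoing c b :=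
  columnNext_incoming σ c b

theorem next_finish (a : Fin k × Bool) : (columns n ε left σ).next (finish a) = start (σ a) :=
  columnNext_finish σ a

theorem isPlain_finish (a : Fin k × Bool) : (columns n ε left σ).IsPlain (finish a) := fun c =>
  ⟨(overIn_eq c).trans_ne (incoming_ne_finish c _ a),
    (underIn_eq c).trans_ne (incoming_ne_finish c _ a)⟩

/-- The columns form a knot diagram. -/
structure IsKnot (n : Fin k → ℕ) (ε : Fin k → ℤˣ) (left : Fin k → Bool)
    (σ : Equiv.Perm (Fin k × Bool)) : Prop where
  nonempty_edge : Nonempty (columns n ε left σ).Edge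
  one_component : (columns n ε left σ).next.IsCycleOn Set.univ
  planar : Fintype.card (columns n ε left σ).Crossing + 2 ≤ Nat.card (columns n ε left σ).Face

/-- The knot diagram formed by columns. -/
noncomputable abbrev knot (h : IsKnot n ε left σ) : KnotDiagram :=
  ⟨columns n ε left σ, h.nonempty_edge, injective_passage n ε left σ, h.one_component, h.planar⟩

open Matrix

section Crossing

variable {R : Type*} [CommRing R] (τ : R)

/-- The left-hand sides minus the right-hand sides of the Wirtinger relations, with `τ = t ^ (-ε)`,
at a crossing of two antiparallel strands.  The generators of the strand `b` above and below the
crossing are `q b` and `q' b`, and `o` is the direction of the overpass. -/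
def crossingDefect (o : Bool) (q q' : Bool → R) : Bool → R
  | true => q' true - q true + if o then 0 else (1 - τ) * (q true - q' false)
  | false => q false - q' false + if o then (1 - τ) * (q' false - q true) else 0

variable {τ}

theorem exists_crossingDefect_eq (hτ : IsUnit τ) (o : Bool) (q w : Bool → R) :
    ∃ q' : Bool → R, ∀ b, crossingDefect τ o q q' b = w b := by
  obtain ⟨τ', hτ'⟩ := hτ.exists_right_inv
  cases o
  · refine ⟨fun b => if b then τ * q true + (1 - τ) * (q false - w false) + w true
      else q false - w false, fun b => ?_⟩
    cases b <;> simp [crossingDefect]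
    ring
  · refine ⟨fun b => if b then q true + w true
      else τ' * (q false - (1 - τ) * q true - w false), fun b => ?_⟩
    cases b <;> simp [crossingDefect]
    linear_combination -(q false - (1 - τ) * q true - w false) * hτ'

theorem exists_levels_crossingDefect_eq (hτ : IsUnit τ) (o : ℕ → Bool) (w : ℕ → Bool → R) :
    ∃ s : ℕ → Bool → R, s 0 = 0 ∧ ∀ i b, crossingDefect τ (o i) (s i) (s (i + 1)) b = w i b := by
  choose next hnext using fun i q => exists_crossingDefect_eq hτ (o i) q (w i)
  exact ⟨fun i => Nat.rec 0 next i, rfl, fun i b => hnext i _ b⟩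

end Crossing

/-- The generators of the edges, from the generators `s j v b` of the strands `(j, b)` at the
levels `v`. -/
def labelling {R : Type*} (s : Fin k → ℕ → Bool → R) (e : ColumnEdge n) : R :=
  s e.1.1 e.level e.1.2

theorem labelling_atLevel {R : Type*} (s : Fin k → ℕ → Bool → R) (j : Fin k) (b : Bool)
    (v : Fin (n j + 1)) : labelling s (atLevel j b v) = s j v b := by
  rw [labelling, level_atLevel]
  rfl

theorem alexanderMatrix_mulVec_incoming (h : IsKnot n ε left σ) (s : Fin k → ℕ → Bool → ℤ[T;T⁻¹])
    (c : Σ j : Fin k, Fin (n j)) (b : Bool) :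
    ((knot h).alexanderMatrix *ᵥ labelling s) (incoming c b) =
      crossingDefect (LaurentPolynomial.T (-(ε c.1 : ℤ))) (overStrand ε left c.1 c.2)
        (s c.1 c.2) (s c.1 (c.2 + 1)) b := by
  have hover := (knot h).alexanderMatrix_mulVec_overIn (labelling s) c
  have hunder := (knot h).alexanderMatrix_mulVec_underIn (labelling s) c
  have hs : ∀ b, labelling s (incoming c b) = s c.1 (if b then c.2 else c.2 + 1) b ∧
      labelling s (outgoing c b) = s c.1 (if b then c.2 + 1 else c.2) b := fun b => by
    cases b <;> exact ⟨labelling_atLevel _ _ _ _, labelling_atLevel _ _ _ _⟩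
  simp only [overIn_eq, underIn_eq] at hover hunder
  rw [next_incoming] at hover hunder
  cases ho : overStrand ε left c.1 c.2 <;> rw [ho] at hover hunder <;> cases b
  · refine hover.trans ?_
    rw [(hs _).1, (hs _).2]
    simp [crossingDefect]
  · refine hunder.trans ?_
    simp only [Bool.not_false, (hs _).1, (hs _).2]
    rfl
  · refine hunder.trans ?_
    simp only [Bool.not_true, (hs _).1, (hs _).2]
    rfl
  · refine hover.trans ?_
    rw [(hs _).1, (hs _).2]
    simp [crossingDefect]

theorem alexanderMatrix_mulVec_finish (h : IsKnot n ε left σ) (s : Fin k → ℕ → Bool → ℤ[T;T⁻¹])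
    (a : Fin k × Bool) :
    ((knot h).alexanderMatrix *ᵥ labelling s) (finish a) =
      s (σ a).1 (if (σ a).2 then 0 else n (σ a).1) (σ a).2 -
        s a.1 (if a.2 then n a.1 else 0) a.2 := by
  refine ((knot h).alexanderMatrix_mulVec_of_forall_ne _
    fun c => (isPlain_finish a c).2).trans ?_
  rw [next_finish]
  simp only [start_eq, finish_eq]
  refine congrArg₂ (· - ·) ((labelling_atLevel _ _ _ _).trans ?_)
    ((labelling_atLevel _ _ _ _).trans ?_) <;> split_ifs <;> rfl

/-- The ratio of the change of the generators at two successive crossings of the column `j` to the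
difference of the generators on its top. -/
noncomputable def shift (ε : Fin k → ℤˣ) (left : Fin k → Bool) (j : Fin k) : ℤ[T;T⁻¹] :=
  if left j = true ↔ ε j = 1 then LaurentPolynomial.T (ε j : ℤ) - 1
  else 1 - LaurentPolynomial.T (-(ε j : ℤ))

/-- The solution of the Wirtinger relations in the columns, with the generators `y` on the top: the
generator of the strand `(j, b)` at the level `v`. -/
noncomputable def solution (ε : Fin k → ℤˣ) (left : Fin k → Bool) (y : Fin k × Bool → ℤ[T;T⁻¹])
    (j : Fin k) (v : ℕ) (b : Bool) : ℤ[T;T⁻¹] :=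
  y (j, b) - (if b = true ↔ (left j = true ↔ ε j = 1) then v / 2 else (v + 1) / 2 : ℕ) *
    shift ε left j * (y (j, true) - y (j, false))

theorem crossingDefect_solution (y : Fin k × Bool → ℤ[T;T⁻¹]) (j : Fin k) (i : ℕ) (b : Bool) :
    crossingDefect (LaurentPolynomial.T (-(ε j : ℤ))) (overStrand ε left j i)
      (solution ε left y j i) (solution ε left y j (i + 1)) b = 0 := by
  have hT : (LaurentPolynomial.T (-(ε j : ℤ)) : ℤ[T;T⁻¹]) * LaurentPolynomial.T (ε j : ℤ) = 1 := by
    rw [← LaurentPolynomial.T_add, neg_add_cancel, LaurentPolynomial.T_zero]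
  have hover : overStrand ε left j i = decide (Even i ↔ (left j = true ↔ ε j = 1)) := by
    simp only [overStrand]; grind
  have heven : ∀ u : ℕ, Even (2 * u) := even_two_mul
  have hodd : ∀ u : ℕ, ¬ Even (2 * u + 1) := fun u => by simp
  have h₁ : ∀ u : ℕ, (2 * u) / 2 = u := by omega
  have h₂ : ∀ u : ℕ, (2 * u + 1) / 2 = u := by omega
  have h₃ : ∀ u : ℕ, (2 * u + 1 + 1) / 2 = u + 1 := by omega
  have h₄ : ∀ u : ℕ, (2 * u + 1 + 1 + 1) / 2 = u + 1 := by omega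
  obtain ⟨u, rfl | rfl⟩ := Nat.even_or_odd' i <;> by_cases h : left j = true ↔ ε j = 1 <;>
    cases b <;>
    simp only [crossingDefect, hover, solution, shift, h, h₁, h₂, h₃, h₄, heven, hodd, iff_true,
      iff_false, not_true, decide_true, decide_false, if_true, if_false,
      Bool.false_eq_true, Nat.cast_add, Nat.cast_one, iff_self]
  · linear_combination (y (j, true) - y (j, false)) * hT
  · ring
  · ring
  · ring
  · ring
  · linear_combination (-(y (j, true) - y (j, false))) * hT
  · ring
  · ring

/-- The relation at the end of the strand `a`, in terms of the generators `y` on the top of the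
columns. -/
noncomputable def relation (n : Fin k → ℕ) (ε : Fin k → ℤˣ) (left : Fin k → Bool)
    (σ : Equiv.Perm (Fin k × Bool)) (y : Fin k × Bool → ℤ[T;T⁻¹]) (a : Fin k × Bool) :
    ℤ[T;T⁻¹] :=
  solution ε left y (σ a).1 (if (σ a).2 then 0 else n (σ a).1) (σ a).2 -
    solution ε left y a.1 (if a.2 then n a.1 else 0) a.2

/-- The matrix of the relations at the ends of the strands, a presentation matrix of the Alexander
module with two generators for each column. -/
noncomputable def relationMatrix (n : Fin k → ℕ) (ε : Fin k → ℤˣ) (left : Fin k → Bool)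
    (σ : Equiv.Perm (Fin k × Bool)) : Matrix (Fin k × Bool) (Fin k × Bool) ℤ[T;T⁻¹] :=
  of fun a x => relation n ε left σ (Pi.single x 1) a

theorem solution_eq_sum (y : Fin k × Bool → ℤ[T;T⁻¹]) (j : Fin k) (v : ℕ) (b : Bool) :
    solution ε left y j v b = ∑ x, solution ε left (Pi.single x 1) j v b * y x := by
  have h : ∀ p, y p = ∑ x, (Pi.single x 1 : Fin k × Bool → ℤ[T;T⁻¹]) p * y x := fun p => by
    simp [Pi.single_apply]
  simp only [solution, sub_mul, mul_assoc, Finset.sum_sub_distrib, ← Finset.mul_sum, ← h]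

theorem relationMatrix_mulVec (y : Fin k × Bool → ℤ[T;T⁻¹]) (a : Fin k × Bool) :
    (relationMatrix n ε left σ *ᵥ y) a = relation n ε left σ y a := by
  simp only [relationMatrix, mulVec, dotProduct, of_apply, relation, sub_mul,
    Finset.sum_sub_distrib, ← solution_eq_sum]

theorem exists_labelling_eq (h : IsKnot n ε left σ)
    (w : (Σ j : Fin k, Fin (n j)) × Bool → ℤ[T;T⁻¹]) :
    ∃ s : Fin k → ℕ → Bool → ℤ[T;T⁻¹], (∀ j, s j 0 = 0) ∧
      ∀ c b, ((knot h).alexanderMatrix *ᵥ labelling s) (incoming c b) = w (c, b) := by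
  have hT : ∀ j, IsUnit (LaurentPolynomial.T (-(ε j : ℤ)) : ℤ[T;T⁻¹]) := fun j =>
    LaurentPolynomial.isUnit_T _
  choose s hs₀ hs using fun j => exists_levels_crossingDefect_eq (hT j) (overStrand ε left j)
    (fun i b => if hi : i < n j then w (⟨j, ⟨i, hi⟩⟩, b) else 0)
  exact ⟨s, hs₀, fun c b => (alexanderMatrix_mulVec_incoming h s c b).trans <|
    (hs c.1 c.2 b).trans (dif_pos c.2.2)⟩

theorem alexanderIdeal_knot (h : IsKnot n ε left σ) :
    (knot h).alexanderIdeal = adjugateIdeal (relationMatrix n ε left σ) := by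
  have : Nonempty (Fin k × Bool) := h.nonempty_edge.map fun e : ColumnEdge n => e.1
  have hsingle : relationMatrix n ε left σ = of fun a x =>
      ((knot h).alexanderMatrix *ᵥ labelling (solution ε left (Pi.single x 1))) (finish a) :=
    Matrix.ext fun a x => (alexanderMatrix_mulVec_finish h _ a).symm
  rw [hsingle]
  refine adjugateIdeal_eq_of_solution (knot h).alexanderMatrix (headEquiv n) (levelEquiv n)
    (fun y => labelling (solution ε left y)) (fun y a => ?_)
    (fun y x => (alexanderMatrix_mulVec_incoming h _ x.1 x.2).trans
      (crossingDefect_solution y x.1.1 x.1.2 x.2)) fun w => ?_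
  · exact (labelling_atLevel _ _ _ _).trans (by simp [solution])
  · obtain ⟨s, hs₀, hs⟩ := exists_labelling_eq h w
    exact ⟨labelling s, fun a => (labelling_atLevel _ _ _ _).trans (congrFun (hs₀ a.1) a.2),
      fun x => hs x.1 x.2⟩

@[simp]
theorem solution_zero (y : Fin k × Bool → ℤ[T;T⁻¹]) (j : Fin k) (b : Bool) :
    solution ε left y j 0 b = y (j, b) := by
  simp [solution]

theorem solution_of_even (y : Fin k × Bool → ℤ[T;T⁻¹]) (j : Fin k) (a : ℕ) (b : Bool) :
    solution ε left y j (a + a) b =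
      y (j, b) - a * shift ε left j * (y (j, true) - y (j, false)) := by
  have h₁ : (a + a) / 2 = a := by omega
  have h₂ : (a + a + 1) / 2 = a := by omega
  simp [solution, h₁, h₂]

theorem solution_of_odd {j : Fin k} (hj : left j = true ↔ ε j = 1)
    (y : Fin k × Bool → ℤ[T;T⁻¹]) (a : ℕ) (b : Bool) :
    solution ε left y j (2 * a + 1) b =
      y (j, b) - (if b then a else a + 1) * shift ε left j * (y (j, true) - y (j, false)) := by
  have h₁ : (2 * a + 1) / 2 = a := by omega
  have h₂ : (2 * a + 1 + 1) / 2 = a + 1 := by omega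
  cases b <;> simp [solution, h₁, h₂, hj]

/-- The connection of the strands of a double twist knot. -/
def doubleTwistPerm : Equiv.Perm (Fin 2 × Bool) where
  toFun := fun a => (a.1 + 1, if a.1 = 0 then a.2 else !a.2)
  invFun := fun a => (a.1 + 1, if a.1 = 1 then a.2 else !a.2)
  left_inv := by unfold Function.LeftInverse; decide
  right_inv := by unfold Function.RightInverse Function.LeftInverse; decide

/-- The connection of the strands of a pretzel knot with three columns. -/
def pretzelPerm : Equiv.Perm (Fin 3 × Bool) where
  toFun := fun a => (a.1 + 1, !a.2)
  invFun := fun a => (a.1 - 1, !a.2)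
  left_inv := by unfold Function.LeftInverse; decide
  right_inv := by unfold Function.RightInverse Function.LeftInverse; decide

theorem adjugateIdeal_relationMatrix_doubleTwistPerm (a : Fin 2 → ℕ) (ε : Fin 2 → ℤˣ)
    (left : Fin 2 → Bool) :
    adjugateIdeal (relationMatrix (fun j => a j + a j) ε left doubleTwistPerm) =
      Ideal.span {1 + (a 0 * shift ε left 0) * (a 1 * shift ε left 1)} := by
  set α := a 0 * shift ε left 0
  set β := a 1 * shift ε left 1
  let r : Fin 2 ⊕ Fin 2 ≃ Fin 2 × Bool := Equiv.ofBijective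
    (Sum.elim ![(0, true), (1, false)] ![(0, false), (1, true)]) (by decide)
  let c : Fin 2 ⊕ Fin 2 ≃ Fin 2 × Bool := Equiv.ofBijective
    (Sum.elim ![(1, true), (1, false)] ![(0, true), (0, false)]) (by decide)
  let extend (z w : Fin 2 → ℤ[T;T⁻¹]) : Fin 2 × Bool → ℤ[T;T⁻¹]
    | (0, true) => z 0
    | (0, false) => z 1
    | (1, true) => w 0
    | (1, false) => w 1
  rw [adjugateIdeal_eq_of_solution _ r c
    (fun z => extend z ![z 0 - α * (z 0 - z 1), z 0])]
  · have hΔ : (of fun i j : Fin 2 => (relationMatrix (fun j => a j + a j) ε left doubleTwistPerm *ᵥ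
        extend (Pi.single j 1) ![(Pi.single j 1 : Fin 2 → ℤ[T;T⁻¹]) 0 -
          α * ((Pi.single j 1 : Fin 2 → ℤ[T;T⁻¹]) 0 - (Pi.single j 1 : Fin 2 → ℤ[T;T⁻¹]) 1),
          (Pi.single j 1 : Fin 2 → ℤ[T;T⁻¹]) 0]) (r (Sum.inr i))) =
        !![1 + α * β, -(1 + α * β); -(1 + α * β), 1 + α * β] := by
      refine Matrix.ext fun i j => ?_
      fin_cases i <;> fin_cases j <;>
        simp [relationMatrix_mulVec, relation, doubleTwistPerm, solution_of_even, r, extend, α,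
          β] <;>
        ring
    rw [hΔ]
    refine adjugateIdeal_eq_span_singleton fun i j => ?_
    rw [adjugate_fin_two]
    fin_cases i <;> fin_cases j <;> simp
  · intro z i
    fin_cases i <;> rfl
  · intro z x
    fin_cases x <;>
      simp [relationMatrix_mulVec, relation, doubleTwistPerm, solution_of_even, r, extend, α]
  · intro w
    refine ⟨extend 0 ![w 0, -w 1], fun i => ?_, fun x => ?_⟩
    · fin_cases i <;> rfl
    · fin_cases x <;>
        simp [relationMatrix_mulVec, relation, doubleTwistPerm, solution_of_even, r, extend]

theorem adjugateIdeal_relationMatrix_pretzelPerm (a : Fin 3 → ℕ) {ε : Fin 3 → ℤˣ}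
    {left : Fin 3 → Bool} (hε : ∀ j, left j = true ↔ ε j = 1) {κ : ℤ[T;T⁻¹]}
    (hκ : ∀ j, shift ε left j = κ) :
    adjugateIdeal (relationMatrix (fun j => 2 * a j + 1) ε left pretzelPerm) =
      Ideal.span
        {1 + κ + (a 0 * a 1 + a 1 * a 2 + a 2 * a 0 + a 0 + a 1 + a 2 + 1) * κ ^ 2} := by
  let r : Fin 3 ⊕ Fin 3 ≃ Fin 3 × Bool := Equiv.ofBijective
    (Sum.elim (fun j => (j, false)) (fun j => (j, true))) (by decide)
  rw [adjugateIdeal_eq_of_solution _ r r (fun y x => if x.2 then y x.1 else y (x.1 + 1))]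
  · let N : Matrix (Fin 3) (Fin 3) ℤ[T;T⁻¹] :=
      !![a 0 * κ - 1, -(a 0 + a 1 + 1) * κ, 1 + (a 1 + 1) * κ;
        1 + (a 2 + 1) * κ, a 1 * κ - 1, -(a 1 + a 2 + 1) * κ;
        -(a 2 + a 0 + 1) * κ, 1 + (a 0 + 1) * κ, a 2 * κ - 1]
    have hN : (of fun i j : Fin 3 => (relationMatrix (fun j => 2 * a j + 1) ε left pretzelPerm *ᵥ
        fun x => if x.2 then (Pi.single j 1 : Fin 3 → ℤ[T;T⁻¹]) x.1 else
          (Pi.single j 1 : Fin 3 → ℤ[T;T⁻¹]) (x.1 + 1)) (r (Sum.inr i))) = N := by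
      refine Matrix.ext fun i j => ?_
      fin_cases i <;> fin_cases j <;>
        simp [relationMatrix_mulVec, relation, pretzelPerm, solution_of_odd (hε _), hκ, N, r,
          Pi.single_apply] <;> ring
    rw [hN]
    refine adjugateIdeal_eq_span_singleton fun i j => ?_
    rw [adjugate_fin_three]
    fin_cases i <;> fin_cases j <;> simp [N] <;> ring
  · exact fun y i => rfl
  · intro y x
    simp [relationMatrix_mulVec, relation, pretzelPerm, r]
  · intro w
    refine ⟨fun x => if x.2 then 0 else -w x.1, fun i => rfl, fun x => ?_⟩
    simp [relationMatrix_mulVec, relation, pretzelPerm, r]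

end columns

namespace KnotDiagram

open LaurentPolynomial

theorem substSq_T (a : ℤ) : substSq (T a) = T (2 * a) := by
  have h : (((isUnit_T (R := ℤ) 2).unit ^ a : ℤ[T;T⁻¹]ˣ) : ℤ[T;T⁻¹]) = T (2 * a) := by
    induction a using Int.induction_on with
    | zero => simp
    | succ i ih => rw [zpow_add_one, Units.val_mul, ih, IsUnit.unit_spec, ← T_add, mul_add_one]
    | pred i ih =>
      rw [zpow_sub_one, Units.val_mul, ih, Units.mul_inv_eq_iff_eq_mul, IsUnit.unit_spec, ← T_add,
        mul_sub_one, sub_add_cancel]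
  rw [substSq, eval₂_T, h]

theorem T_one_mul_T_neg_one : (T 1 * T (-1) : ℤ[T;T⁻¹]) = 1 := by
  rw [← T_add, add_neg_cancel, T_zero]

theorem isConway_of_alexanderIdeal {D : KnotDiagram} (u : ℤ) {a : ℤ}
    (h : D.alexanderIdeal = Ideal.span {T u * (1 + (a : ℤ[T;T⁻¹]) * (T 1 - 2 + T (-1)))}) :
    D.IsConway (1 + Polynomial.C a * Polynomial.X ^ 2) := by
  refine ⟨by simp [Polynomial.coeff_one], ?_⟩
  rw [h, Ideal.map_span, Set.image_singleton, map_mul, substSq_T,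
    Ideal.span_singleton_mul_left_unit (isUnit_T _)]
  congr 2
  have hs : substSq (1 + (a : ℤ[T;T⁻¹]) * (T 1 - 2 + T (-1))) =
      1 + (a : ℤ[T;T⁻¹]) * (T 2 - 2 + T (-2)) := by
    simp only [map_add, map_mul, map_sub, map_one, map_intCast, map_ofNat, substSq_T]
    norm_num
  have hz : substZ (1 + Polynomial.C a * Polynomial.X ^ 2) =
      1 + (a : ℤ[T;T⁻¹]) * (T 1 - T (-1)) ^ 2 := by
    simp only [substZ, Polynomial.coe_eval₂RingHom, Polynomial.eval₂_add, Polynomial.eval₂_one,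
      Polynomial.eval₂_mul, Polynomial.eval₂_C, Polynomial.eval₂_pow, Polynomial.eval₂_X]
    rw [eq_intCast C a]
  have h₂ : (T 2 : ℤ[T;T⁻¹]) = T 1 * T 1 := by rw [← T_add]; rfl
  have h₂' : (T (-2) : ℤ[T;T⁻¹]) = T (-1) * T (-1) := by rw [← T_add]; rfl
  rw [hs, hz, h₂, h₂']
  linear_combination (-2 * a : ℤ[T;T⁻¹]) * T_one_mul_T_neg_one

end KnotDiagram

namespace columns

theorem isKnot_doubleTwistKnot {ℓ m : ℤ} (hℓ : Even ℓ) (hm : Even m) :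
    IsKnot ![ℓ.natAbs, m.natAbs] ![if 0 < ℓ then -1 else 1, if 0 < m then -1 else 1]
      ![true, false] doubleTwistPerm :=
  ⟨(doubleTwistKnot ℓ m hℓ hm).nonempty_edge, (doubleTwistKnot ℓ m hℓ hm).one_component,
    (doubleTwistKnot ℓ m hℓ hm).planar⟩

theorem doubleTwistKnot_eq_knot {ℓ m : ℤ} (hℓ : Even ℓ) (hm : Even m) :
    doubleTwistKnot ℓ m hℓ hm = knot (isKnot_doubleTwistKnot hℓ hm) :=
  rfl

theorem isKnot_pretzelKnot {p q r : ℕ} (hp : Odd p) (hq : Odd q) (hr : Odd r) :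
    IsKnot ![p, q, r] (fun _ => 1) (fun _ => true) pretzelPerm :=
  ⟨(pretzelKnot p q r hp hq hr).nonempty_edge, (pretzelKnot p q r hp hq hr).one_component,
    (pretzelKnot p q r hp hq hr).planar⟩

theorem pretzelKnot_eq_knot {p q r : ℕ} (hp : Odd p) (hq : Odd q) (hr : Odd r) :
    pretzelKnot p q r hp hq hr = knot (isKnot_pretzelKnot hp hq hr) :=
  rfl

open LaurentPolynomial in
theorem natAbs_mul_shift {k : ℕ} {ε : Fin k → ℤˣ} {left : Fin k → Bool} {j : Fin k} {a : ℤ}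
    (hε : ε j = if 0 < a + a then -1 else 1) :
    (a.natAbs : ℤ[T;T⁻¹]) * shift ε left j = a * if left j then 1 - T 1 else T (-1) - 1 := by
  rw [shift, hε]
  rcases lt_or_ge 0 (a + a) with h | h
  · rw [if_pos h]
    lift a to ℕ using (pos_add_self_iff.1 h).le
    cases left j <;> simp
  · rw [if_neg h.not_gt]
    obtain ⟨a, rfl⟩ := Int.exists_eq_neg_ofNat (show a ≤ 0 by omega)
    cases left j <;> simp <;> ring

end columns

open columns LaurentPolynomial in
theorem isConway_doubleTwistKnot (a b : ℤ) :
    (doubleTwistKnot (a + a) (b + b) (.add_self a) (.add_self b)).IsConway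
      (1 + Polynomial.C (a * b) * Polynomial.X ^ 2) := by
  refine KnotDiagram.isConway_of_alexanderIdeal 0 ?_
  have hn : ![(a + a).natAbs, (b + b).natAbs] =
      fun j => ![a.natAbs, b.natAbs] j + ![a.natAbs, b.natAbs] j := by
    ext j
    fin_cases j <;> simp <;> omega
  rw [doubleTwistKnot_eq_knot, alexanderIdeal_knot, hn,
    adjugateIdeal_relationMatrix_doubleTwistPerm]
  congr 2
  simp only [Matrix.cons_val_zero, Matrix.cons_val_one]
  rw [natAbs_mul_shift rfl, natAbs_mul_shift rfl]
  simp only [Matrix.cons_val_zero, Matrix.cons_val_one, if_true, Bool.false_eq_true, if_false,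
    T_zero, one_mul, Int.cast_mul]
  linear_combination (-(a * b) : ℤ[T;T⁻¹]) * KnotDiagram.T_one_mul_T_neg_one

open columns LaurentPolynomial in
theorem isConway_pretzelKnot (a b c : ℕ) :
    (pretzelKnot (2 * a + 1) (2 * b + 1) (2 * c + 1) (odd_two_mul_add_one a)
      (odd_two_mul_add_one b) (odd_two_mul_add_one c)).IsConway
      (1 + Polynomial.C (a * b + b * c + c * a + a + b + c + 1 : ℤ) * Polynomial.X ^ 2) := by
  refine KnotDiagram.isConway_of_alexanderIdeal 1 ?_
  have hn : ![2 * a + 1, 2 * b + 1, 2 * c + 1] = fun j => 2 * ![a, b, c] j + 1 := by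
    ext j
    fin_cases j <;> rfl
  rw [pretzelKnot_eq_knot, alexanderIdeal_knot, hn,
    adjugateIdeal_relationMatrix_pretzelPerm _ (by simp) (κ := T 1 - 1) (by simp [shift])]
  congr 2
  simp only [Matrix.cons_val]
  push_cast
  linear_combination
    (-(a * b + b * c + c * a + a + b + c + 1) : ℤ[T;T⁻¹]) * KnotDiagram.T_one_mul_T_neg_one

theorem conway_doubleTwistKnot {ℓ m : ℤ} (hℓ : Even ℓ) (hm : Even m) :
    (doubleTwistKnot ℓ m hℓ hm).conway.map (Int.castRingHom ℚ) =
      1 + Polynomial.C ((ℓ * m : ℚ) / 4) * Polynomial.X ^ 2 := by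
  obtain ⟨a, rfl⟩ := hℓ
  obtain ⟨b, rfl⟩ := hm
  have h : ((a + a : ℤ) * (b + b : ℤ) : ℚ) / 4 = Int.castRingHom ℚ (a * b) := by
    push_cast [eq_intCast]
    ring
  rw [(isConway_doubleTwistKnot a b).conway_eq, h]
  simp only [Polynomial.map_add, Polynomial.map_one, Polynomial.map_mul, Polynomial.map_C,
    Polynomial.map_pow, Polynomial.map_X]

theorem conway_pretzelKnot {p q r : ℕ} (hp : Odd p) (hq : Odd q) (hr : Odd r) :
    (pretzelKnot p q r hp hq hr).conway.map (Int.castRingHom ℚ) =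
      1 + Polynomial.C ((1 / 4 : ℚ) * (p * q + q * r + r * p + 1)) * Polynomial.X ^ 2 := by
  obtain ⟨a, rfl⟩ := hp
  obtain ⟨b, rfl⟩ := hq
  obtain ⟨c, rfl⟩ := hr
  have h : (1 / 4 : ℚ) * ((2 * a + 1 : ℕ) * (2 * b + 1 : ℕ) + (2 * b + 1 : ℕ) * (2 * c + 1 : ℕ) +
      (2 * c + 1 : ℕ) * (2 * a + 1 : ℕ) + 1) =
      Int.castRingHom ℚ (a * b + b * c + c * a + a + b + c + 1) := by
    push_cast [eq_intCast]
    ring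
  rw [(isConway_pretzelKnot a b c).conway_eq, h]
  simp only [Polynomial.map_add, Polynomial.map_one, Polynomial.map_mul, Polynomial.map_C,
    Polynomial.map_pow, Polynomial.map_X]

theorem card_quot_congr {α : Type*} {r s : α → α → Prop}
    (hr : ∀ x y, r x y → Quot.mk s x = Quot.mk s y)
    (hs : ∀ x y, s x y → Quot.mk r x = Quot.mk r y) : Nat.card (Quot r) = Nat.card (Quot s) :=
  Nat.card_congr
    { toFun := Quot.lift (Quot.mk s) hr
      invFun := Quot.lift (Quot.mk r) hs
      left_inv := by rintro ⟨x⟩; rfl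
      right_inv := by rintro ⟨x⟩; rfl }

section CountBefore

variable {m : ℕ} (f : Fin m → Bool)

/-- The number of values `true` of a finite sequence before the position `v`. -/
def countBefore (v : ℕ) : ℕ := Nat.count (fun i => ∃ h : i < m, f ⟨i, h⟩ = true) v

theorem countBefore_zero : countBefore f 0 = 0 := Nat.count_zero _

theorem countBefore_succ (i : Fin m) :
    countBefore f (i + 1) = countBefore f i + if f i then 1 else 0 := by
  simp [countBefore, Nat.count_succ]

theorem countBefore_mono : Monotone (countBefore f) := Nat.count_monotone _

theorem countBefore_last : countBefore f m = (Finset.univ.filter fun i => f i = true).card := by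
  rw [countBefore, Nat.count_eq_card_filter_range, Finset.card_filter, Finset.card_filter,
    ← Fin.sum_univ_eq_sum_range (fun i => if ∃ h : i < m, f ⟨i, h⟩ = true then 1 else 0)]
  simp

theorem countBefore_last_ne_zero_iff : countBefore f m ≠ 0 ↔ ∃ i, f i = true := by
  simp [countBefore_last]

theorem exists_countBefore_eq {c : ℕ} (hc : c < countBefore f m) :
    ∃ v : Fin (m + 1), countBefore f v = c :=
  ⟨⟨Nat.nth _ c, (Nat.nth_lt_of_lt_count hc).trans m.lt_succ_self⟩,
    Nat.count_nth fun hfin => hc.trans_le (Nat.count_le_card hfin m)⟩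

end CountBefore

namespace columns

open ColumnEdge

variable {k : ℕ} {n : Fin k → ℕ} (σ : Equiv.Perm (Fin k × Bool)) (o : ∀ j : Fin k, Fin (n j) → Bool)

/-- The edges that are joined directly when exactly the crossings with `o c.1 c.2 = true` are
smoothed according to the orientation. -/
inductive Smoothed : ColumnEdge n → ColumnEdge n → Prop
  | plain (a : Fin k × Bool) : Smoothed (finish a) (start (σ a))
  | turn (c : Σ j : Fin k, Fin (n j)) (b : Bool) (h : o c.1 c.2 = true) :
      Smoothed (incoming c b) (outgoing c !b)
  | passIn (c : Σ j : Fin k, Fin (n j)) (b : Bool) (h : o c.1 c.2 = false) :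
      Smoothed (incoming c b) (incoming c !b)
  | passOut (c : Σ j : Fin k, Fin (n j)) (b : Bool) (h : o c.1 c.2 = false) :
      Smoothed (outgoing c b) (outgoing c !b)

/-- The number of crossings of the column `j` that are smoothed according to the orientation. -/
def cuts (j : Fin k) : ℕ := countBefore (o j) (n j)

variable {o} in
theorem cuts_ne_zero {j : Fin k} {i : Fin (n j)} (h : o j i = true) : cuts o j ≠ 0 :=
  (countBefore_last_ne_zero_iff _).2 ⟨i, h⟩

/-- Whether the column `j` has an even number of crossings. -/
abbrev isEven (n : Fin k → ℕ) (j : Fin k) : Bool := decide (Even (n j))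

/-- Whether some crossing of the column `j` is smoothed according to the orientation. -/
abbrev isCut (j : Fin k) : Bool := decide (cuts o j ≠ 0)

/-- The strands whose first edges are joined when the column `j` is replaced by an arc above and
an arc below (`t j = true`), or by two vertical strands (`t j = false`).  In the second case each
strand changes its side at every crossing, so that only the parity of the number of crossings
matters. -/
def ArcJoined (even t : Fin k → Bool) (x y : Fin k × Bool) : Prop :=
  ∃ j, (t j = true ∧ ∃ b, x = (j, b) ∧ y = σ (j, !b)) ∨
    (t j = false ∧ even j = true ∧ ∃ b, x = (j, b) ∧ y = σ (j, b)) ∨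
    (t j = false ∧ even j = false ∧ (x = (j, true) ∧ y = (j, false) ∨
      x = σ (j, true) ∧ y = σ (j, false)))

instance (even t : Fin k → Bool) (x y : Fin k × Bool) : Decidable (ArcJoined σ even t x y) := by
  unfold ArcJoined; infer_instance

/-- The number of circles if every column is replaced by two arcs as in `ArcJoined`. -/
noncomputable def arcLoops (even t : Fin k → Bool) : ℕ := Nat.card (Quot (ArcJoined σ even t))

/-- The circle of the smoothed diagram through an edge. -/
abbrev loopThrough (e : ColumnEdge n) : Quot (Smoothed σ o) := Quot.mk _ e

variable {σ o}

theorem loopThrough_start (a : Fin k × Bool) :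
    loopThrough σ o (start (σ a)) = loopThrough σ o (finish a) :=
  (Quot.sound (Smoothed.plain a)).symm

theorem loopThrough_castSucc_of_false {j : Fin k} {i : Fin (n j)} (h : o j i = false) (b : Bool) :
    loopThrough σ o (atLevel j b i.castSucc) = loopThrough σ o (atLevel j (!b) i.succ) := by
  cases b
  · exact Quot.sound (Smoothed.passOut ⟨j, i⟩ false h)
  · exact Quot.sound (Smoothed.passIn ⟨j, i⟩ true h)

theorem loopThrough_true_eq_false {j : Fin k} (h : cuts o j ≠ 0) (v : Fin (n j + 1)) :
    loopThrough σ o (atLevel j true v) = loopThrough σ o (atLevel j false v) := by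
  have iff_zero : ∀ v, loopThrough σ o (atLevel j true v) = loopThrough σ o (atLevel j false v) ↔
      loopThrough σ o (atLevel j true 0) = loopThrough σ o (atLevel j false 0) := by
    intro v
    induction v using Fin.induction with
    | zero => rfl
    | succ i ih =>
      rw [← ih]
      cases hi : o j i
      · rw [loopThrough_castSucc_of_false hi, loopThrough_castSucc_of_false hi]
        exact eq_comm
      · exact iff_of_true (Quot.sound (Smoothed.turn ⟨j, i⟩ false hi)).symm
          (Quot.sound (Smoothed.turn ⟨j, i⟩ true hi))
  obtain ⟨i, hi⟩ := (countBefore_last_ne_zero_iff _).1 h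
  exact (iff_zero v).2 ((iff_zero i.castSucc).1 (Quot.sound (Smoothed.turn ⟨j, i⟩ true hi)))

theorem loopThrough_eq_true {j : Fin k} (h : cuts o j ≠ 0) (b : Bool) (v : Fin (n j + 1)) :
    loopThrough σ o (atLevel j b v) = loopThrough σ o (atLevel j true v) := by
  cases b
  · exact (loopThrough_true_eq_false h v).symm
  · rfl

theorem loopThrough_eq_of_countBefore_eq {j : Fin k} (h : cuts o j ≠ 0) (b b' : Bool)
    {v w : Fin (n j + 1)} (hvw : countBefore (o j) v = countBefore (o j) w) :
    loopThrough σ o (atLevel j b v) = loopThrough σ o (atLevel j b' w) := by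
  have of_le : ∀ v w : Fin (n j + 1), v ≤ w → countBefore (o j) v = countBefore (o j) w →
      loopThrough σ o (atLevel j true v) = loopThrough σ o (atLevel j true w) := by
    intro v w hle hcount
    induction w using Fin.induction with
    | zero => rw [Fin.le_zero_iff.1 hle]
    | succ i ih =>
      rcases hle.eq_or_lt with rfl | hlt
      · rfl
      have hle' : v ≤ i.castSucc := Fin.le_castSucc_iff.2 hlt
      have hsucc := countBefore_succ (o j) i
      have hmono : countBefore (o j) v ≤ countBefore (o j) i := countBefore_mono _ hle'
      rw [Fin.val_succ] at hcount
      cases hi : o j i <;> simp only [hi, Bool.false_eq_true, if_true, if_false] at hsucc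
      · rw [ih hle' (by rw [Fin.val_castSucc]; omega), loopThrough_castSucc_of_false hi,
          loopThrough_eq_true h]
      · omega
  rw [loopThrough_eq_true h, loopThrough_eq_true h b']
  rcases le_total v w with hle | hle
  · exact of_le v w hle hvw
  · exact (of_le w v hle hvw.symm).symm

theorem loopThrough_eq_level_zero {j : Fin k} (h : cuts o j = 0) (b : Bool) (v : Fin (n j + 1)) :
    loopThrough σ o (atLevel j b v) =
      loopThrough σ o (atLevel j (decide (b = true ↔ Even v.val)) 0) := by
  induction v using Fin.induction generalizing b with
  | zero => simp
  | succ i ih =>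
    have hi : o j i = false := Bool.eq_false_iff.2 fun hi => cuts_ne_zero hi h
    have hpass := loopThrough_castSucc_of_false (σ := σ) hi (!b)
    rw [Bool.not_not] at hpass
    rw [← hpass, ih]
    cases b <;> simp [Nat.even_add_one]

theorem loopThrough_start_eq_of_arcJoined {x y : Fin k × Bool}
    (h : ArcJoined σ (isEven n) (isCut o) x y) :
    loopThrough σ o (start x) = loopThrough σ o (start y) := by
  obtain ⟨j, ⟨hcut, b, rfl, rfl⟩ | ⟨hcut, heven, b, rfl, rfl⟩ |
    ⟨hcut, heven, ⟨rfl, rfl⟩ | ⟨rfl, rfl⟩⟩⟩ := h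
  all_goals simp only [isCut, decide_eq_true_eq, decide_eq_false_iff_not, not_not]
    at hcut
  · rw [loopThrough_start, start_eq, finish_eq]
    cases b
    · exact (loopThrough_true_eq_false hcut _).symm
    · exact loopThrough_true_eq_false hcut _
  all_goals
    have hbottom := fun b => loopThrough_eq_level_zero (σ := σ) hcut b (Fin.last (n j))
    simp only [isEven, decide_eq_true_eq, decide_eq_false_iff_not] at heven
  · rw [loopThrough_start, start_eq, finish_eq]
    cases b
    · simpa [heven] using hbottom false
    · simpa [heven] using (hbottom true).symm
  · rw [start_eq, start_eq]
    simpa [heven] using (hbottom false).symm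
  · rw [loopThrough_start, loopThrough_start, finish_eq, finish_eq]
    simpa [heven] using hbottom true

variable (σ o) in
/-- The circles of the smoothed diagram: those that leave a column, and the ones between consecutive
oriented smoothings of a column. -/
abbrev Circle : Type :=
  Quot (ArcJoined σ (isEven n) (isCut o)) ⊕ Σ j : Fin k, Fin (cuts o j - 1)

variable (σ o) in
/-- The circle through the edge of the strand `(j, b)` at the level `v`. -/
def circle (j : Fin k) (b : Bool) (v : ℕ) : Circle σ o :=
  if h : 0 < countBefore (o j) v ∧ countBefore (o j) v < cuts o j then
    .inr ⟨j, ⟨countBefore (o j) v - 1, by omega⟩⟩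
  else .inl (Quot.mk _ (if cuts o j = 0 then
      (if b = true ↔ Even v then (j, true) else σ (j, false))
    else if countBefore (o j) v = 0 then (j, true) else (j, false)))

theorem circle_zero (j : Fin k) (b : Bool) :
    circle σ o j b 0 = .inl (Quot.mk _ (if cuts o j = 0 then
      (if b then (j, true) else σ (j, false)) else (j, true))) := by
  simp [circle, countBefore_zero]

theorem circle_last (j : Fin k) (b : Bool) :
    circle σ o j b (n j) = .inl (Quot.mk _ (if cuts o j = 0 then
      (if b = true ↔ Even (n j) then (j, true) else σ (j, false)) else (j, false))) := by
  have hnot : ¬ (0 < countBefore (o j) (n j) ∧ countBefore (o j) (n j) < cuts o j) := fun h =>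
    h.2.ne rfl
  rw [circle, dif_neg hnot]
  congr 2
  split_ifs with h h' h'' <;> first | rfl | exact absurd h'' h

theorem circle_start (a : Fin k × Bool) :
    circle σ o a.1 a.2 (if a.2 then 0 else n a.1) = .inl (Quot.mk _ a) := by
  obtain ⟨j, b⟩ := a
  cases b
  · rw [if_neg Bool.false_ne_true, circle_last]
    congr 1
    by_cases hcut : cuts o j = 0
    · by_cases heven : Even (n j)
      · simp only [hcut, heven, if_true, Bool.false_eq_true, iff_true, if_false]
        exact (Quot.sound
          ⟨j, Or.inr (Or.inl ⟨by simp [hcut], by simp [heven], false, rfl, rfl⟩)⟩).symm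
      · simp only [hcut, heven, if_true, Bool.false_eq_true]
        exact Quot.sound ⟨j, Or.inr (Or.inr ⟨by simp [hcut], by simp [heven], Or.inl ⟨rfl, rfl⟩⟩)⟩
    · rw [if_neg hcut]
  · simp [circle_zero]

theorem circle_finish (a : Fin k × Bool) :
    circle σ o a.1 a.2 (if a.2 then n a.1 else 0) = .inl (Quot.mk _ (σ a)) := by
  obtain ⟨j, b⟩ := a
  by_cases hcut : cuts o j = 0
  · cases b
    · simp [circle_zero, hcut]
    · simp only [if_true, circle_last, hcut, true_iff]
      congr 1
      by_cases heven : Even (n j)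
      · rw [if_pos heven]
        exact Quot.sound ⟨j, Or.inr (Or.inl ⟨by simp [hcut], by simp [heven], true, rfl, rfl⟩)⟩
      · rw [if_neg heven]
        exact (Quot.sound
          ⟨j, Or.inr (Or.inr ⟨by simp [hcut], by simp [heven], Or.inr ⟨rfl, rfl⟩⟩)⟩).symm
  · have hsound : ∀ b, Quot.mk (ArcJoined σ (isEven n) (isCut o)) (j, !b) = Quot.mk _ (σ (j, b)) :=
      fun b => Quot.sound ⟨j, Or.inl ⟨by simp [hcut], !b, rfl, by rw [Bool.not_not]⟩⟩
    cases b
    · simpa [circle_zero, hcut] using hsound false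
    · simpa [circle_last, hcut] using hsound true

theorem circle_eq_of_cuts_ne_zero {j : Fin k} (h : cuts o j ≠ 0) (b b' : Bool) (v : ℕ) :
    circle σ o j b v = circle σ o j b' v := by
  simp only [circle, if_neg h]

theorem circle_eq_of_false {j : Fin k} {i : Fin (n j)} (h : o j i = false) (b : Bool) :
    circle σ o j b i = circle σ o j (!b) (i + 1) := by
  have hcount : countBefore (o j) (i + 1) = countBefore (o j) i := by simp [countBefore_succ, h]
  have hparity : (b = true ↔ Even i.val) ↔ ((!b) = true ↔ Even (i.val + 1)) := by
    cases b <;> simp [Nat.even_add_one]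
  simp only [circle, hcount, hparity]

variable (σ o) in
/-- The circle through an edge. -/
def circleThrough (e : ColumnEdge n) : Circle σ o := circle σ o e.1.1 e.1.2 e.level

theorem circleThrough_atLevel (j : Fin k) (b : Bool) (v : Fin (n j + 1)) :
    circleThrough σ o (atLevel j b v) = circle σ o j b v := by
  rw [circleThrough, level_atLevel]
  rfl

theorem circleThrough_start (a : Fin k × Bool) :
    circleThrough σ o (start a) = .inl (Quot.mk _ a) := by
  rw [start_eq, circleThrough_atLevel, ← circle_start]
  cases a.2 <;> rfl

theorem circleThrough_finish (a : Fin k × Bool) :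
    circleThrough σ o (finish a) = .inl (Quot.mk _ (σ a)) := by
  rw [finish_eq, circleThrough_atLevel, ← circle_finish]
  cases a.2 <;> rfl

theorem circleThrough_eq_of_smoothed {e f : ColumnEdge n} (h : Smoothed σ o e f) :
    circleThrough σ o e = circleThrough σ o f := by
  cases h with
  | plain a => rw [circleThrough_finish, circleThrough_start]
  | turn c b h =>
    rw [incoming, outgoing, circleThrough_atLevel, circleThrough_atLevel]
    cases b <;> exact circle_eq_of_cuts_ne_zero (cuts_ne_zero h) _ _ _
  | passIn c b h =>
    rw [incoming, incoming, circleThrough_atLevel, circleThrough_atLevel]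
    cases b
    · exact (circle_eq_of_false h true).symm
    · exact circle_eq_of_false h true
  | passOut c b h =>
    rw [outgoing, outgoing, circleThrough_atLevel, circleThrough_atLevel]
    cases b
    · exact circle_eq_of_false h false
    · exact (circle_eq_of_false h false).symm

theorem exists_level_of_circle (x : Σ j : Fin k, Fin (cuts o j - 1)) :
    ∃ v : Fin (n x.1 + 1), countBefore (o x.1) v = x.2 + 1 :=
  exists_countBefore_eq _ (show _ < cuts o x.1 by omega)

variable (σ o) in
/-- The inverse of `circleThrough` on the circles. -/
noncomputable def loopOfCircle : Circle σ o → Quot (Smoothed σ o) :=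
  Sum.elim (Quot.lift (fun a => loopThrough σ o (start a))
      fun _ _ => loopThrough_start_eq_of_arcJoined)
    fun x => loopThrough σ o (atLevel x.1 true (exists_level_of_circle x).choose)

theorem loopOfCircle_circle (j : Fin k) (b : Bool) (w : Fin (n j + 1)) :
    loopOfCircle σ o (circle σ o j b w) = loopThrough σ o (atLevel j b w) := by
  unfold circle
  split_ifs with hinner hcut hparity hzero
  · exact loopThrough_eq_of_countBefore_eq (hinner.1.trans hinner.2).ne' _ _
      ((exists_level_of_circle ⟨j, ⟨_, _⟩⟩).choose_spec.trans (Nat.sub_add_cancel hinner.1))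
  · change loopThrough σ o (start (j, true)) = _
    rw [start_eq, loopThrough_eq_level_zero hcut b w, decide_eq_true hparity]
    rfl
  · change loopThrough σ o (start (σ (j, false))) = _
    rw [loopThrough_start, finish_eq, loopThrough_eq_level_zero hcut b w, decide_eq_false hparity]
    rfl
  · change loopThrough σ o (start (j, true)) = _
    rw [start_eq]
    exact loopThrough_eq_of_countBefore_eq hcut _ _ ((countBefore_zero _).trans hzero.symm)
  · change loopThrough σ o (start (j, false)) = _
    rw [start_eq]
    have hle : countBefore (o j) w ≤ cuts o j := countBefore_mono _ (Nat.lt_succ_iff.1 w.2)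
    have heq : cuts o j = countBefore (o j) w :=
      hle.eq_or_lt.resolve_right (fun hlt => hinner ⟨Nat.pos_of_ne_zero hzero, hlt⟩) |>.symm
    exact loopThrough_eq_of_countBefore_eq hcut _ _ heq

variable (σ o) in
/-- The two descriptions of the circles of the smoothed diagram. -/
noncomputable def circleEquiv : Quot (Smoothed σ o) ≃ Circle σ o where
  toFun := Quot.lift (circleThrough σ o) fun _ _ => circleThrough_eq_of_smoothed
  invFun := loopOfCircle σ o
  left_inv := by
    rintro ⟨e⟩
    exact (loopOfCircle_circle _ _ _).trans (congrArg (Quot.mk _) (atLevel_level e))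
  right_inv := by
    rintro (⟨⟨a⟩⟩ | x)
    · exact circleThrough_start a
    · have hcount := (exists_level_of_circle x).choose_spec
      have := x.2.2
      refine (circleThrough_atLevel _ _ _).trans ?_
      rw [circle, dif_pos ⟨by omega, by omega⟩]
      simp [hcount]

theorem card_quot_smoothed :
    Nat.card (Quot (Smoothed σ o)) = arcLoops σ (isEven n) (isCut o) + ∑ j, (cuts o j - 1) := by
  rw [Nat.card_congr (circleEquiv σ o), Nat.card_sum, arcLoops]
  simp

end columns

namespace columns

open ColumnEdge

variable {k : ℕ} {n : Fin k → ℕ} {ε : Fin k → ℤˣ} {left : Fin k → Bool}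
  {σ : Equiv.Perm (Fin k × Bool)}

/-- A state, described by the crossings that are smoothed according to the orientation. -/
def oriented (n : Fin k → ℕ) (ε : Fin k → ℤˣ) :
    ((Σ j : Fin k, Fin (n j)) → Bool) ≃ ∀ j : Fin k, Fin (n j) → Bool where
  toFun s j i := decide (s ⟨j, i⟩ = true ↔ ε j = 1)
  invFun o c := decide (o c.1 c.2 = true ↔ ε c.1 = 1)
  left_inv s := by
    ext c
    by_cases h : ε c.1 = 1 <;> simp [h]
  right_inv o := by
    ext j i
    by_cases h : ε j = 1 <;> simp [h]

theorem eq_finish_of_isPlain {e : ColumnEdge n} (h : (columns n ε left σ).IsPlain e) :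
    e = finish e.1 := by
  have hlast := isPlain_iff n ε left σ e h
  refine ColumnEdge.ext' rfl ?_
  simp only [Fin.val_last] at hlast ⊢
  omega

theorem next_overIn (c : Σ j : Fin k, Fin (n j)) :
    (columns n ε left σ).next ((columns n ε left σ).overIn c) =
      outgoing c (overStrand ε left c.1 c.2) := by
  rw [overIn_eq, next_incoming]

theorem next_underIn (c : Σ j : Fin k, Fin (n j)) :
    (columns n ε left σ).next ((columns n ε left σ).underIn c) =
      outgoing c (!overStrand ε left c.1 c.2) := by
  rw [underIn_eq, next_incoming]

theorem loopThrough_eq_of_joined (h : IsKnot n ε left σ) (s : (Σ j : Fin k, Fin (n j)) → Bool)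
    {x y : (knot h).Edge} (hxy : (knot h).Joined s x y) :
    loopThrough σ (oriented n ε s) x = loopThrough σ (oriented n ε s) y := by
  have of_eq : ∀ {x x' y y' : ColumnEdge n}, x = x' → y = y' →
      loopThrough σ (oriented n ε s) x' = loopThrough σ (oriented n ε s) y' →
      loopThrough σ (oriented n ε s) x = loopThrough σ (oriented n ε s) y := by
    rintro x _ y _ rfl rfl h
    exact h
  cases hxy with
  | plain _ hplain =>
    have hfinish := eq_finish_of_isPlain hplain
    exact of_eq hfinish ((congrArg _ hfinish).trans (next_finish _)) (loopThrough_start _).symm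
  | oriented_under c hc =>
    have hturn := Quot.sound (Smoothed.turn (σ := σ) (o := oriented n ε s) c
      (!overStrand ε left c.1 c.2) (decide_eq_true hc))
    rw [Bool.not_not] at hturn
    exact of_eq (underIn_eq c) (next_overIn c) hturn
  | oriented_over c hc =>
    exact of_eq (overIn_eq c) (next_underIn c) (Quot.sound (.turn c _ (decide_eq_true hc)))
  | unoriented_in c hc =>
    exact of_eq (underIn_eq c) (overIn_eq c) (Quot.sound (.passIn c _ (decide_eq_false hc))).symm
  | unoriented_out c hc =>
    exact of_eq (next_underIn c) (next_overIn c)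
      (Quot.sound (.passOut c _ (decide_eq_false hc))).symm

theorem mk_joined_eq_of_smoothed (h : IsKnot n ε left σ) (s : (Σ j : Fin k, Fin (n j)) → Bool)
    {x y : ColumnEdge n} (hxy : Smoothed σ (oriented n ε s) x y) :
    Quot.mk ((knot h).Joined s) x = Quot.mk ((knot h).Joined s) y := by
  have bool_cases : ∀ (c : Σ j : Fin k, Fin (n j)) (b : Bool),
      b = overStrand ε left c.1 c.2 ∨ b = !overStrand ε left c.1 c.2 := fun c b =>
    Bool.eq_or_eq_not b _
  cases hxy with
  | plain a =>
    have hsound := Quot.sound (KnotDiagram.Joined.plain (D := knot h) (s := s) (finish a)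
      (isPlain_finish a))
    rwa [next_finish] at hsound
  | turn c b hc =>
    have hover := Quot.sound (KnotDiagram.Joined.oriented_over (D := knot h) (s := s) c
      (of_decide_eq_true hc))
    have hunder := Quot.sound (KnotDiagram.Joined.oriented_under (D := knot h) (s := s) c
      (of_decide_eq_true hc))
    rw [next_underIn, overIn_eq] at hover
    rw [next_overIn, underIn_eq] at hunder
    rcases bool_cases c b with rfl | rfl
    · exact hover
    · rwa [Bool.not_not]
  | passIn c b hc =>
    have hin := Quot.sound (KnotDiagram.Joined.unoriented_in (D := knot h) (s := s) c
      (of_decide_eq_false hc))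
    rw [overIn_eq, underIn_eq] at hin
    rcases bool_cases c b with rfl | rfl
    · exact hin.symm
    · rwa [Bool.not_not]
  | passOut c b hc =>
    have hout := Quot.sound (KnotDiagram.Joined.unoriented_out (D := knot h) (s := s) c
      (of_decide_eq_false hc))
    rw [next_underIn, next_overIn] at hout
    rcases bool_cases c b with rfl | rfl
    · exact hout.symm
    · rwa [Bool.not_not]

theorem loops_knot (h : IsKnot n ε left σ) (s : (Σ j : Fin k, Fin (n j)) → Bool) :
    (knot h).loops s = arcLoops σ (isEven n) (isCut (oriented n ε s)) +
      ∑ j, (cuts (oriented n ε s) j - 1) :=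
  (card_quot_congr (fun _ _ => loopThrough_eq_of_joined h s)
    fun _ _ => mk_joined_eq_of_smoothed h s).trans card_quot_smoothed

end columns

theorem sum_pi_mul_prod_fiberwise {ι R : Type*} [Fintype ι] [DecidableEq ι] [CommSemiring R]
    {α : ι → Type*} [∀ i, Fintype (α i)] {β : ι → Type*} [∀ i, Fintype (β i)]
    [∀ i, DecidableEq (β i)] (τ : ∀ i, α i → β i) (G : (∀ i, β i) → R) (g : ∀ i, α i → R) :
    ∑ a : ∀ i, α i, G (fun i => τ i (a i)) * ∏ i, g i (a i) =
      ∑ t : ∀ i, β i, G t * ∏ i, ∑ x : α i, if τ i x = t i then g i x else 0 := by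
  simp only [Finset.prod_univ_sum, Fintype.piFinset_univ, Finset.mul_sum]
  rw [Finset.sum_comm]
  refine Finset.sum_congr rfl fun a _ => ?_
  rw [Finset.sum_eq_single (fun i => τ i (a i))]
  · simp
  · intro t _ ht
    obtain ⟨i, hi⟩ := Function.ne_iff.1 ht
    rw [Finset.prod_eq_zero (Finset.mem_univ i) (if_neg (Ne.symm hi)), mul_zero]
  · simp

theorem zpow_sum {ι G : Type*} [CommGroup G] (a : G) (s : Finset ι) (f : ι → ℤ) :
    a ^ (∑ i ∈ s, f i) = ∏ i ∈ s, a ^ f i :=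
  map_prod (zpowersHom G a) (fun i => Multiplicative.ofAdd (f i)) s

section ColumnSum

variable {R : Type*} [CommRing R] (m : ℕ) (x y δ : R)

/-- The contribution to the state sum of those states of a column of `m` crossings that have an
oriented smoothing (`b = true`), or no oriented smoothing (`b = false`).  The oriented and the other
smoothings have the weights `x` and `y`, and a circle has the weight `δ`. -/
def columnSum (b : Bool) : R :=
  ∑ f : Fin m → Bool, if decide (countBefore f m ≠ 0) = b then
    (∏ i, if f i then x else y) * δ ^ (countBefore f m - 1) else 0

theorem columnSum_false : columnSum m x y δ false = y ^ m := by
  rw [columnSum, Finset.sum_eq_single (fun _ => false)]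
  · simp [countBefore_last]
  · intro f _ hf
    obtain ⟨i, hi⟩ := Function.ne_iff.1 hf
    have hcut := (countBefore_last_ne_zero_iff f).2 ⟨i, by simpa using hi⟩
    exact if_neg (by simp [hcut])
  · simp

theorem sum_prod_mul_pow_countBefore :
    ∑ f : Fin m → Bool, (∏ i, if f i then x else y) * δ ^ countBefore f m = (x * δ + y) ^ m := by
  have hexpand := Fintype.prod_sum (fun (_ : Fin m) (b : Bool) => if b then x * δ else y)
  simp only [Fintype.univ_bool, Finset.sum_insert, Finset.mem_singleton, Bool.true_eq_false,
    not_false_eq_true, Finset.sum_singleton, if_true, Bool.false_eq_true, if_false,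
    Finset.prod_const, Finset.card_univ, Fintype.card_fin] at hexpand
  rw [hexpand]
  refine Finset.sum_congr rfl fun f _ => ?_
  rw [countBefore_last, ← Finset.prod_const, Finset.prod_filter, ← Finset.prod_mul_distrib]
  refine Finset.prod_congr rfl fun i _ => ?_
  split_ifs <;> simp

theorem mul_columnSum_true : δ * columnSum m x y δ true = (x * δ + y) ^ m - y ^ m := by
  rw [← sum_prod_mul_pow_countBefore, ← columnSum_false m x y δ, columnSum, columnSum,
    Finset.mul_sum, ← Finset.sum_sub_distrib]
  refine Finset.sum_congr rfl fun f _ => ?_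
  rcases countBefore f m with _ | c
  · simp
  · simp [pow_succ]
    ring

end ColumnSum

namespace KnotDiagram

/-- The value `-A² - A⁻²` of a circle in the Kauffman bracket. -/
def loopValue {R : Type*} [CommRing R] (A : Rˣ) : R := -(A ^ (2 : ℤ) : Rˣ) - (A ^ (-2 : ℤ) : Rˣ)

theorem loops_pos (D : KnotDiagram) (s : D.State) : 0 < D.loops s := by
  have : Finite D.Edge := Finite.of_fintype _
  have : Nonempty (Quot (D.Joined s)) := D.nonempty_edge.map (Quot.mk _)
  exact Nat.card_pos

theorem loopValue_mul_eval₂_kauffmanBracket {R : Type*} [CommRing R] (D : KnotDiagram) (A : Rˣ) :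
    loopValue A * LaurentPolynomial.eval₂ (Int.castRingHom R) A D.kauffmanBracket =
      ∑ s : D.State, ((A ^ (∑ c, if s c then 1 else -1 : ℤ) : Rˣ) : R) *
        loopValue A ^ D.loops s := by
  rw [kauffmanBracket, map_sum, Finset.mul_sum]
  refine Finset.sum_congr rfl fun s _ => ?_
  have hvalue : LaurentPolynomial.eval₂ (Int.castRingHom R) A
      (-LaurentPolynomial.T 2 - LaurentPolynomial.T (-2)) = loopValue A := by
    rw [map_sub, map_neg, LaurentPolynomial.eval₂_T, LaurentPolynomial.eval₂_T, loopValue]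
  rw [map_mul, map_pow, hvalue, LaurentPolynomial.eval₂_T, mul_left_comm, ← pow_succ',
    Nat.sub_add_cancel (D.loops_pos s)]

/-- The value `t ^ (-1/4)` of the variable `A` of the bracket in the Jones polynomial. -/
noncomputable def bracketVariable (t : ℝ) : ℝˣ :=
  Units.mk0 (Real.exp (-Real.log t / 4)) (Real.exp_ne_zero _)

theorem bracketVariable_zpow_neg_four {t : ℝ} (ht : 0 < t) :
    ((bracketVariable t ^ (-4 : ℤ) : ℝˣ) : ℝ) = t := by
  rw [Units.val_zpow_eq_zpow_val, bracketVariable, Units.val_mk0, ← Real.rpow_intCast,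
    ← Real.exp_mul, mul_comm]
  have hlog : ((-4 : ℤ) : ℝ) * (-Real.log t / 4) = Real.log t := by push_cast; ring
  rw [hlog, Real.exp_log ht]

theorem loopValue_sq {R : Type*} [CommRing R] (A : Rˣ) :
    loopValue A ^ 2 = (A ^ (-4 : ℤ) : Rˣ) + 2 + ((A ^ (-4 : ℤ))⁻¹ : Rˣ) := by
  have hunit : ((A ^ (2 : ℤ) : Rˣ) : R) * (A ^ (-2 : ℤ) : Rˣ) = 1 := by
    rw [← Units.val_mul, ← zpow_add]
    simp
  have hsq : ∀ e : ℤ, ((A ^ (2 * e) : Rˣ) : R) = ((A ^ e : Rˣ) : R) ^ 2 := fun e => by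
    rw [mul_comm, zpow_mul]
    rfl
  rw [← zpow_neg, show (-4 : ℤ) = 2 * -2 from rfl, show (-(2 * -2) : ℤ) = 2 * 2 from rfl, hsq, hsq,
    loopValue]
  linear_combination 2 * hunit

theorem loopValue_bracketVariable_sq {t : ℝ} (ht : 0 < t) :
    loopValue (bracketVariable t) ^ 2 = t + 2 + t⁻¹ := by
  rw [loopValue_sq, Units.val_inv_eq_inv_val, bracketVariable_zpow_neg_four ht]

theorem loopValue_bracketVariable_ne_zero {t : ℝ} (ht : 0 < t) :
    loopValue (bracketVariable t) ≠ 0 := fun h => by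
  have hsq := loopValue_bracketVariable_sq ht
  have hpos : 0 < t + 2 + t⁻¹ := by positivity
  rw [h] at hsq
  linarith

theorem jones_eq (D : KnotDiagram) (t : ℝ) :
    D.jones t = (((-1 : ℤˣ) ^ D.writhe : ℤˣ) : ℤ) *
      ((bracketVariable t ^ (-3 * D.writhe) : ℝˣ) : ℝ) *
        LaurentPolynomial.eval₂ (Int.castRingHom ℝ) (bracketVariable t) D.kauffmanBracket := by
  rw [jones, normalizedBracket, map_mul, map_mul, LaurentPolynomial.eval₂_C,
    LaurentPolynomial.eval₂_T]
  rfl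

end KnotDiagram

namespace columns

open KnotDiagram

variable {k : ℕ} {n : Fin k → ℕ} {ε : Fin k → ℤˣ} {left : Fin k → Bool}
  {σ : Equiv.Perm (Fin k × Bool)}

theorem zpow_sum_state {G : Type*} [CommGroup G] (A : G) (s : (Σ j : Fin k, Fin (n j)) → Bool) :
    A ^ (∑ c, if s c then 1 else -1 : ℤ) =
      ∏ j, ∏ i, if oriented n ε s j i then A ^ (ε j : ℤ) else A ^ (-(ε j : ℤ)) := by
  rw [zpow_sum, Fintype.prod_sigma]
  refine Finset.prod_congr rfl fun j _ => Finset.prod_congr rfl fun i _ => ?_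
  rcases Int.units_eq_one_or (ε j) with h | h <;> cases hs : s ⟨j, i⟩ <;> simp [oriented, h, hs]

theorem loopValue_mul_eval₂_kauffmanBracket_knot {R : Type*} [CommRing R]
    (h : IsKnot n ε left σ) (A : Rˣ) :
    loopValue A * LaurentPolynomial.eval₂ (Int.castRingHom R) A (knot h).kauffmanBracket =
      ∑ t : Fin k → Bool, loopValue A ^ arcLoops σ (isEven n) t *
        ∏ j, columnSum (n j) ((A ^ (ε j : ℤ) : Rˣ) : R) ((A ^ (-(ε j : ℤ)) : Rˣ) : R)
          (loopValue A) (t j) := by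
  simp only [columnSum]
  rw [loopValue_mul_eval₂_kauffmanBracket,
    ← sum_pi_mul_prod_fiberwise (fun j f => decide (countBefore f (n j) ≠ 0))
      (fun t => loopValue A ^ arcLoops σ (isEven n) t), ← (oriented n ε).sum_comp]
  refine Finset.sum_congr rfl fun s _ => ?_
  have hweight := congrArg (Units.val (α := R)) (zpow_sum_state (ε := ε) A s)
  simp only [Units.coe_prod, apply_ite (Units.val (α := R))] at hweight
  refine (congrArg₂ (· * ·) hweight (congrArg (loopValue A ^ ·) (loops_knot h s))).trans ?_
  simp only [pow_add, Finset.prod_mul_distrib, Finset.prod_pow_eq_pow_sum, cuts]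
  exact mul_left_comm _ _ _

theorem writhe_knot (h : IsKnot n ε left σ) : (knot h).writhe = ∑ j, (ε j : ℤ) * n j := by
  change ∑ c : (Σ j : Fin k, Fin (n j)), ((ε c.1 : ℤˣ) : ℤ) = _
  rw [Fintype.sum_sigma]
  simp [mul_comm]

theorem zpow_mul_loopValue_add {R : Type*} [CommRing R] (A : Rˣ) (e : ℤˣ) :
    ((A ^ (e : ℤ) : Rˣ) : R) * loopValue A + (A ^ (-(e : ℤ)) : Rˣ) = -(A ^ (3 * (e : ℤ)) : Rˣ) := by
  rw [loopValue, mul_sub, mul_neg, ← Units.val_mul, ← Units.val_mul, ← zpow_add, ← zpow_add]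
  rcases Int.units_eq_one_or e with rfl | rfl
  · norm_num
  · norm_num
    ring

theorem zpow_mul_columnSum_false {R : Type*} [CommRing R] (A : Rˣ) (e : ℤˣ) (m : ℕ) :
    ((A ^ (-3 * ((e : ℤ) * m)) : Rˣ) : R) *
      columnSum m ((A ^ (e : ℤ) : Rˣ) : R) ((A ^ (-(e : ℤ)) : Rˣ) : R) (loopValue A) false =
      (((A ^ (-4 : ℤ)) ^ ((e : ℤ) * m) : Rˣ) : R) := by
  rw [columnSum_false, ← Units.val_pow_eq_pow_val, ← Units.val_mul, ← zpow_natCast, ← zpow_mul,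
    ← zpow_add, ← zpow_mul]
  congr 2
  ring

theorem zpow_mul_columnSum_true {R : Type*} [CommRing R] (A : Rˣ) (e : ℤˣ) (m : ℕ) :
    loopValue A * (((A ^ (-3 * ((e : ℤ) * m)) : Rˣ) : R) *
      columnSum m ((A ^ (e : ℤ) : Rˣ) : R) ((A ^ (-(e : ℤ)) : Rˣ) : R) (loopValue A) true) =
      (-1) ^ m - (((A ^ (-4 : ℤ)) ^ ((e : ℤ) * m) : Rˣ) : R) := by
  have hcancel : ((A ^ (-3 * ((e : ℤ) * m)) : Rˣ) : R) * ((A ^ (3 * (e : ℤ)) : Rˣ) : R) ^ m =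
      1 := by
    rw [← Units.val_pow_eq_pow_val, ← Units.val_mul, ← zpow_natCast, ← zpow_mul, ← zpow_add]
    ring_nf
    simp
  have hfalse := zpow_mul_columnSum_false A e m
  rw [columnSum_false] at hfalse
  rw [mul_left_comm, mul_columnSum_true, zpow_mul_loopValue_add, mul_sub, hfalse, neg_pow]
  linear_combination (-1) ^ m * hcancel

theorem loopValue_mul_jones_knot (h : IsKnot n ε left σ) {t : ℝ} (ht : 0 < t) :
    loopValue (bracketVariable t) * (knot h).jones t =
      ((-1 : ℤˣ) ^ (∑ j, (ε j : ℤ) * n j) : ℤˣ) *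
        ∑ s : Fin k → Bool, loopValue (bracketVariable t) ^ arcLoops σ (isEven n) s *
          ∏ j, if s j then ((-1) ^ n j - t ^ ((ε j : ℤ) * n j)) / loopValue (bracketVariable t)
            else t ^ ((ε j : ℤ) * n j) := by
  set A := bracketVariable t with hA
  have hvar : ∀ e : ℤ, (((A ^ (-4 : ℤ)) ^ e : ℝˣ) : ℝ) = t ^ e := fun e => by
    rw [Units.val_zpow_eq_zpow_val, bracketVariable_zpow_neg_four ht]
  have hcolumn : ∀ j b, ((A ^ (-3 * ((ε j : ℤ) * n j)) : ℝˣ) : ℝ) *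
      columnSum (n j) ((A ^ (ε j : ℤ) : ℝˣ) : ℝ) ((A ^ (-(ε j : ℤ)) : ℝˣ) : ℝ) (loopValue A) b =
      if b then ((-1) ^ n j - t ^ ((ε j : ℤ) * n j)) / loopValue A
        else t ^ ((ε j : ℤ) * n j) := by
    rintro j (_ | _)
    · rw [zpow_mul_columnSum_false, hvar, if_neg Bool.false_ne_true]
    · rw [if_pos rfl, eq_div_iff (loopValue_bracketVariable_ne_zero ht), mul_comm,
        zpow_mul_columnSum_true, hvar]
  rw [jones_eq, writhe_knot, ← hA, mul_left_comm, mul_assoc,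
    loopValue_mul_eval₂_kauffmanBracket_knot, Finset.mul_sum Finset.univ _ (-3), zpow_sum A,
    Units.coe_prod]
  congr 1
  rw [Finset.mul_sum]
  simp only [mul_left_comm _ (loopValue A ^ _), ← Finset.prod_mul_distrib, hcolumn]

end columns

theorem sum_fin_succ_pi {n : ℕ} {α M : Type*} [Fintype α] [AddCommMonoid M]
    (F : (Fin (n + 1) → α) → M) :
    ∑ s, F s = ∑ a, ∑ s : Fin n → α, F (Matrix.vecCons a s) := by
  rw [← (Fin.consEquiv fun _ => α).sum_comp, Fintype.sum_prod_type]
  rfl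

theorem quot_mk_eq_of_path {α : Type*} {r : α → α → Prop} {x w : α}
    (h : ∃ y, (x = y ∨ r x y ∨ r y x) ∧ ∃ z, (y = z ∨ r y z ∨ r z y) ∧
      (z = w ∨ r z w ∨ r w z)) :
    Quot.mk r x = Quot.mk r w := by
  have hstep : ∀ {x y}, (x = y ∨ r x y ∨ r y x) → Quot.mk r x = Quot.mk r y := by
    rintro x y (rfl | h | h)
    exacts [rfl, Quot.sound h, (Quot.sound h).symm]
  obtain ⟨y, hxy, z, hyz, hzw⟩ := h
  exact (hstep hxy).trans ((hstep hyz).trans (hstep hzw))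

theorem card_quot_eq_card_image {α : Type*} [Fintype α] [DecidableEq α] {r : α → α → Prop}
    (ρ : α → α) (hρ : ∀ x y, r x y → ρ x = ρ y) (hmk : ∀ x, Quot.mk r x = Quot.mk r (ρ x)) :
    Nat.card (Quot r) = (Finset.univ.image ρ).card := by
  rw [← Set.ncard_coe_finset, Finset.coe_image, Finset.coe_univ, Set.image_univ,
    ← Nat.card_coe_set_eq]
  refine Nat.card_congr (Equiv.ofBijective (Quot.lift (Set.rangeFactorization ρ)
    fun x y h => Subtype.ext (hρ x y h)) ⟨?_, ?_⟩)
  · rintro ⟨x⟩ ⟨y⟩ h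
    exact (hmk x).trans ((congrArg (Quot.mk r) (congrArg Subtype.val h)).trans (hmk y).symm)
  · rintro ⟨_, x, rfl⟩
    exact ⟨Quot.mk _ x, rfl⟩

namespace columns

theorem arcLoops_doubleTwistPerm (s : Fin 2 → Bool) :
    arcLoops doubleTwistPerm (fun _ => true) s = if s 0 = s 1 then 1 else 2 := by
  rw [arcLoops, card_quot_eq_card_image (fun x =>
    if s 0 = s 1 then (0, true) else (0, xor x.2 (s 0 && decide (x.1 = 1))))
    (by decide +revert) fun x => quot_mk_eq_of_path (by decide +revert)]
  decide +revert

theorem arcLoops_pretzelPerm (s : Fin 3 → Bool) :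
    arcLoops pretzelPerm (fun _ => false) s =
      if s 0 ∧ s 1 ∧ s 2 then 2 else 3 - ∑ j, (s j).toNat := by
  -- A column `j` with `s j` joins the strands `(j, b)` and `(j + 1, b)`, any other one joins its
  -- own two strands.
  rw [arcLoops, card_quot_eq_card_image (fun x =>
    if s 0 ∧ s 1 ∧ s 2 then (0, x.2)
    else (if s (x.1 - 1) then (if s (x.1 - 2) then x.1 - 2 else x.1 - 1) else x.1, true))
    (by decide +revert) fun x => quot_mk_eq_of_path (by decide +revert)]
  decide +revert

section ArcSums

variable {R : Type*} [CommSemiring R] (δ : R)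

theorem sum_pow_arcLoops_doubleTwistPerm (x y : Fin 2 → R) :
    ∑ s, δ ^ arcLoops doubleTwistPerm (fun _ => true) s * ∏ j, (if s j then x j else y j) =
      δ * (x 0 * x 1 + y 0 * y 1) + δ ^ 2 * (x 0 * y 1 + y 0 * x 1) := by
  simp only [sum_fin_succ_pi, Fintype.sum_bool, Fintype.sum_unique, arcLoops_doubleTwistPerm,
    Fin.prod_univ_two, Matrix.cons_val, if_true, Bool.false_eq_true, Bool.true_eq_false, if_false]
  ring

theorem sum_pow_arcLoops_pretzelPerm (x y : Fin 3 → R) :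
    ∑ s, δ ^ arcLoops pretzelPerm (fun _ => false) s * ∏ j, (if s j then x j else y j) =
      δ ^ 2 * (x 0 * x 1 * x 2) +
        δ * (x 0 * x 1 * y 2 + x 1 * x 2 * y 0 + x 2 * x 0 * y 1) +
        δ ^ 2 * (x 0 * y 1 * y 2 + x 1 * y 2 * y 0 + x 2 * y 0 * y 1) +
        δ ^ 3 * (y 0 * y 1 * y 2) := by
  simp only [sum_fin_succ_pi, Fintype.sum_bool, Fintype.sum_unique, arcLoops_pretzelPerm,
    Fin.sum_univ_three, Fin.prod_univ_three, Matrix.cons_val, Bool.toNat_true, Bool.toNat_false,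
    if_true, Bool.false_eq_true, if_false, and_true, and_false,
    Nat.reduceAdd, Nat.reduceSub]
  ring

end ArcSums

end columns

section JonesPolynomial

open columns KnotDiagram

theorem div_one_add_sq_eq_inv_loopValue_sq {t : ℝ} (ht : 0 < t) :
    t / (1 + t) ^ 2 = (loopValue (bracketVariable t) ^ 2)⁻¹ := by
  rw [loopValue_bracketVariable_sq ht]
  field_simp
  ring

theorem ite_neg_mul_natAbs (a : ℤ) :
    (((if 0 < a then -1 else 1 : ℤˣ) : ℤˣ) : ℤ) * (a.natAbs : ℤ) = -a := by
  split_ifs <;> simp <;> omega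

theorem jones_doubleTwistKnot {ℓ m : ℤ} (hℓ : Even ℓ) (hm : Even m) {t : ℝ} (ht : 0 < t) :
    (doubleTwistKnot ℓ m hℓ hm).jones t =
      1 - (1 - t ^ (-ℓ)) * (1 - t ^ (-m)) * (1 - t / (1 + t) ^ 2) := by
  have hδ := loopValue_bracketVariable_ne_zero ht
  have heven : isEven ![ℓ.natAbs, m.natAbs] = fun _ => true := by
    funext j
    fin_cases j <;> simpa
  have hsign : (-1 : ℤˣ) ^ (-ℓ + -m) = 1 := (hℓ.neg.add hm.neg).neg_one_zpow
  refine mul_left_cancel₀ hδ ?_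
  rw [doubleTwistKnot_eq_knot, loopValue_mul_jones_knot _ ht, heven,
    sum_pow_arcLoops_doubleTwistPerm, Fin.sum_univ_two]
  simp only [Matrix.cons_val_zero, Matrix.cons_val_one, ite_neg_mul_natAbs, hsign,
    (Int.natAbs_even.2 hℓ).neg_one_pow, (Int.natAbs_even.2 hm).neg_one_pow,
    div_one_add_sq_eq_inv_loopValue_sq ht, Units.val_one, Int.cast_one]
  field_simp
  ring

theorem jones_pretzelKnot {p q r : ℕ} (hp : Odd p) (hq : Odd q) (hr : Odd r) {t : ℝ} (ht : 0 < t) :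
    (pretzelKnot p q r hp hq hr).jones t =
      (t ^ p * t ^ q + t ^ q * t ^ r + t ^ r * t ^ p) + t ^ p * t ^ q * t ^ r * (1 - t - t⁻¹) +
        t / (1 + t) ^ 2 * (1 - (t ^ p * t ^ q + t ^ q * t ^ r + t ^ r * t ^ p) -
          2 * (t ^ p * t ^ q * t ^ r)) := by
  have hδ := loopValue_bracketVariable_ne_zero ht
  have hinv : t⁻¹ = loopValue (bracketVariable t) ^ 2 - t - 2 := by
    rw [loopValue_bracketVariable_sq ht]
    ring
  have heven : isEven ![p, q, r] = fun _ => false := by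
    funext j
    fin_cases j <;> simpa
  have hsign : (-1 : ℤˣ) ^ (p + q + r) = -1 := ((hp.add_odd hq).add_odd hr).neg_one_pow
  refine mul_left_cancel₀ hδ ?_
  rw [pretzelKnot_eq_knot, loopValue_mul_jones_knot _ ht, heven, sum_pow_arcLoops_pretzelPerm,
    Fin.sum_univ_three, div_one_add_sq_eq_inv_loopValue_sq ht, hinv]
  simp only [Matrix.cons_val, Units.val_one, one_mul, zpow_natCast, ← Nat.cast_add, hsign,
    hp.neg_one_pow, hq.neg_one_pow, hr.neg_one_pow, Units.val_neg, Int.cast_neg, Int.cast_one]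
  field_simp
  ring

end JonesPolynomial

/-- The function `f` has the derivatives `c 0, …, c N` of order `0, …, N` at `x`.  The values of `c`
beyond `N` are irrelevant. -/
structure HasJet {𝕜 : Type*} [NontriviallyNormedField 𝕜] (N : ℕ) (f : 𝕜 → 𝕜) (x : 𝕜)
    (c : ℕ → 𝕜) : Prop where
  contDiffAt : ContDiffAt 𝕜 N f x
  iteratedDeriv_eq : ∀ n ≤ N, iteratedDeriv n f x = c n

namespace HasJet

variable {𝕜 : Type*} [NontriviallyNormedField 𝕜] {N : ℕ} {f g : 𝕜 → 𝕜} {x : 𝕜} {a b : ℕ → 𝕜}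

theorem contDiffAt_of_le (hf : HasJet N f x a) {n : ℕ} (hn : n ≤ N) : ContDiffAt 𝕜 n f x :=
  hf.contDiffAt.of_le (by exact_mod_cast hn)

theorem congr (hf : HasJet N f x a) (h : g =ᶠ[nhds x] f) : HasJet N g x a where
  contDiffAt := hf.contDiffAt.congr_of_eventuallyEq h
  iteratedDeriv_eq n hn := (h.iteratedDeriv_eq n).trans (hf.iteratedDeriv_eq n hn)

theorem const (c : 𝕜) : HasJet N (fun _ => c) x (fun n => if n = 0 then c else 0) where
  contDiffAt := contDiffAt_const
  iteratedDeriv_eq _ _ := iteratedDeriv_const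

theorem add (hf : HasJet N f x a) (hg : HasJet N g x b) :
    HasJet N (fun t => f t + g t) x (fun n => a n + b n) where
  contDiffAt := hf.contDiffAt.add hg.contDiffAt
  iteratedDeriv_eq n hn := by
    rw [← hf.iteratedDeriv_eq n hn, ← hg.iteratedDeriv_eq n hn]
    exact iteratedDeriv_fun_add (hf.contDiffAt_of_le hn) (hg.contDiffAt_of_le hn)

theorem sub (hf : HasJet N f x a) (hg : HasJet N g x b) :
    HasJet N (fun t => f t - g t) x (fun n => a n - b n) where
  contDiffAt := hf.contDiffAt.sub hg.contDiffAt
  iteratedDeriv_eq n hn := by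
    rw [← hf.iteratedDeriv_eq n hn, ← hg.iteratedDeriv_eq n hn]
    exact iteratedDeriv_fun_sub (hf.contDiffAt_of_le hn) (hg.contDiffAt_of_le hn)

theorem mul (hf : HasJet N f x a) (hg : HasJet N g x b) :
    HasJet N (fun t => f t * g t) x
      (fun n => ∑ i ∈ Finset.range (n + 1), n.choose i * a i * b (n - i)) where
  contDiffAt := hf.contDiffAt.mul hg.contDiffAt
  iteratedDeriv_eq n hn := by
    rw [iteratedDeriv_fun_mul (hf.contDiffAt_of_le hn) (hg.contDiffAt_of_le hn)]
    refine Finset.sum_congr rfl fun i hi => ?_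
    rw [hf.iteratedDeriv_eq i (by grind), hg.iteratedDeriv_eq (n - i) (by grind)]

theorem comp_const_add (s : 𝕜) (hf : HasJet N f (s + x) a) : HasJet N (fun t => f (s + t)) x a where
  contDiffAt := hf.contDiffAt.comp x (contDiffAt_const.add contDiffAt_id)
  iteratedDeriv_eq n hn := by
    rw [iteratedDeriv_comp_const_add]
    exact hf.iteratedDeriv_eq n hn

theorem zpow (hx : x ≠ 0) (e : ℤ) :
    HasJet N (fun t => t ^ e) x
      (fun n => (∏ i ∈ Finset.range n, ((e : 𝕜) - i)) * x ^ (e - n)) where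
  contDiffAt := by
    obtain ⟨m, rfl | rfl⟩ := e.eq_nat_or_neg
    · simp only [zpow_natCast]
      exact contDiffAt_id.pow m
    · simp only [zpow_neg, zpow_natCast]
      exact (contDiffAt_id.pow m).fun_inv (pow_ne_zero m hx)
  iteratedDeriv_eq n _ := by rw [iteratedDeriv_eq_iterate, iter_deriv_zpow]

theorem pow (hx : x ≠ 0) (m : ℕ) :
    HasJet N (fun t => t ^ m) x
      (fun n => (∏ i ∈ Finset.range n, ((m : 𝕜) - i)) * x ^ ((m : ℤ) - n)) := by
  simpa only [zpow_natCast, Int.cast_natCast] using zpow hx (m : ℤ)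

theorem id (hx : x ≠ 0) :
    HasJet N (fun t => t) x
      (fun n => (∏ i ∈ Finset.range n, ((1 : ℕ) - i : 𝕜)) * x ^ ((1 : ℕ) - n : ℤ)) := by
  simpa only [pow_one] using pow hx 1

theorem inv (hx : x ≠ 0) :
    HasJet N (fun t => t⁻¹) x
      (fun n => (∏ i ∈ Finset.range n, ((-1 : ℤ) - i : 𝕜)) * x ^ (-1 - n : ℤ)) := by
  simpa only [zpow_neg_one] using zpow hx (-1)

end HasJet

theorem hasJet_div_one_add_sq {N : ℕ} :
    HasJet N (fun t : ℝ => t / (1 + t) ^ 2) 1 (fun n =>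
      (∏ i ∈ Finset.range n, ((-1 : ℤ) - i : ℝ)) * (1 + 1) ^ (-1 - n : ℤ) -
        (∏ i ∈ Finset.range n, ((-2 : ℤ) - i : ℝ)) * (1 + 1) ^ (-2 - n : ℤ)) := by
  have hpow : ∀ e : ℤ, HasJet N (fun t : ℝ => (1 + t) ^ e) 1 _ := fun e =>
    (HasJet.zpow (by norm_num) e).comp_const_add 1
  refine ((hpow (-1)).sub (hpow (-2))).congr ?_
  filter_upwards [lt_mem_nhds zero_lt_one] with t ht
  have ht' : 1 + t ≠ 0 := by positivity
  simp only [zpow_neg]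
  norm_cast
  field_simp
  ring

theorem v₃_doubleTwistKnot {ℓ m : ℤ} (hℓ : Even ℓ) (hm : Even m) :
    (doubleTwistKnot ℓ m hℓ hm).v₃ = -((m * ℓ : ℝ) / 64) * (ℓ + m) := by
  have hpow : ∀ e : ℤ, HasJet 3 (fun t : ℝ => t ^ e) 1 _ := HasJet.zpow one_ne_zero
  have one : HasJet 3 (fun _ : ℝ => 1) 1 _ := HasJet.const 1
  have h := (one.sub (((one.sub (hpow (-ℓ))).mul (one.sub (hpow (-m)))).mul
    (one.sub hasJet_div_one_add_sq))).congr (g := (doubleTwistKnot ℓ m hℓ hm).jones) (by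
      filter_upwards [lt_mem_nhds zero_lt_one] with t ht
      exact jones_doubleTwistKnot hℓ hm ht)
  rw [KnotDiagram.v₃, h.iteratedDeriv_eq 2 (by norm_num), h.iteratedDeriv_eq 3 le_rfl]
  norm_num [Finset.sum_range_succ, Finset.prod_range_succ, Nat.choose]
  ring

theorem v₃_pretzelKnot {p q r : ℕ} (hp : Odd p) (hq : Odd q) (hr : Odd r) :
    (pretzelKnot p q r hp hq hr).v₃ =
      (1 / 64 : ℝ) * ((p + q + r + 1) * (p * q + q * r + r * p + 1) +
        (p - 1) * (q - 1) * (r - 1)) := by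
  have hpow : ∀ e : ℕ, HasJet 3 (fun t : ℝ => t ^ e) 1 _ := HasJet.pow one_ne_zero
  have const : ∀ c : ℝ, HasJet 3 (fun _ => c) 1 _ := HasJet.const
  have id : HasJet 3 (fun t : ℝ => t) 1 _ := HasJet.id one_ne_zero
  have inv : HasJet 3 (fun t : ℝ => t⁻¹) 1 _ := HasJet.inv one_ne_zero
  have sum := (((hpow p).mul (hpow q)).add ((hpow q).mul (hpow r))).add ((hpow r).mul (hpow p))
  have prod := ((hpow p).mul (hpow q)).mul (hpow r)
  have h := ((sum.add (prod.mul (((const 1).sub id).sub inv))).add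
    (hasJet_div_one_add_sq.mul (((const 1).sub sum).sub ((const 2).mul prod)))).congr
    (g := (pretzelKnot p q r hp hq hr).jones) (by
      filter_upwards [lt_mem_nhds zero_lt_one] with t ht
      exact jones_pretzelKnot hp hq hr ht)
  rw [KnotDiagram.v₃, h.iteratedDeriv_eq 2 (by norm_num), h.iteratedDeriv_eq 3 le_rfl]
  norm_num [Finset.sum_range_succ, Finset.prod_range_succ, Nat.choose]
  ring

theorem proposition6p5 :
    (∀ (ℓ m : ℤ) (hℓ : Even ℓ) (hm : Even m),
      (doubleTwistKnot ℓ m hℓ hm).conway.map (Int.castRingHom ℚ) =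
        1 + Polynomial.C ((ℓ * m : ℚ) / 4) * Polynomial.X ^ 2 ∧
      (doubleTwistKnot ℓ m hℓ hm).v₃ = -((m * ℓ : ℝ) / 64) * (ℓ + m)) ∧
    (∀ (p q r : ℕ) (hp : Odd p) (hq : Odd q) (hr : Odd r),
      (pretzelKnot p q r hp hq hr).conway.map (Int.castRingHom ℚ) =
        1 + Polynomial.C ((1 / 4 : ℚ) * (p * q + q * r + r * p + 1)) * Polynomial.X ^ 2 ∧
      (pretzelKnot p q r hp hq hr).v₃ =
        (1 / 64 : ℝ) * ((p + q + r + 1) * (p * q + q * r + r * p + 1) +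
          (p - 1) * (q - 1) * (r - 1))) :=
  ⟨fun _ _ hℓ hm => ⟨conway_doubleTwistKnot hℓ hm, v₃_doubleTwistKnot hℓ hm⟩,
    fun _ _ _ hp hq hr => ⟨conway_pretzelKnot hp hq hr, v₃_pretzelKnot hp hq hr⟩⟩
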